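/- Proposition 3.1. Let $F=F(X)$ be the free group on a finite alphabet $X$. For a subgroup $H\le F$ write $H^g=g^{-1}Hg$. Call $H$ *conjugacy stable* if any two elements of $H$ that are conjugate in $F$ are conjugate in $H$. Call a finite list $g_1,\dots,g_k\in F$ a *system of BNTCI representatives* for $H$ if every $g\in F$ with $H^g\cap H\ne 1$ lies in $Hg_iH$ for some $i$. Call $h\in F$ a *root element* if it is not of the form $a^n$ with $a\in F$, $n\ge 2$. Subgroups are given to an algorithm by finite lists of words in $X^{\pm1}$ that generate them. Then: 1. There is an algorithm that decides, given a finite list of words generating $H\le F$, whether $H$ is conjugacy stable. 2. There is an algorithm that, given such a list, computes a system of BNTCI representatives for $H$ (as words), together with, for each representative $g$ in it, a finite list of words generating $gHg^{-1}\cap H$. 3. Let $H\le F$ be finitely generated and let $R$ be any system of BNTCI representatives for $H$. Then $H$ is conjugacy stable if and only if for every $g\in R$ with $g\notin H$ and $gHg^{-1}\cap H\neq 1$ there are a root element $h_g\in F$ and an integer $n_g\ge 2$ such that $gHg^{-1}\cap H=\langle h_g^{n_g}\rangle$ and $H\cap\langle h_g\rangle g\ne\varnothing$. -/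

import Mathlib

/-- A subgroup `H` of `G` is conjugacy stable if any two elements of `H` that are conjugate in `G`
are already conjugate in `H`. -/
def ConjugacyStable {G : Type*} [Group G] (H : Subgroup G) : Prop :=
  ∀ u v : H, IsConj (u : G) (v : G) → IsConj u v

/-- The conjugate `g H g⁻¹`. -/
def conjBy {G : Type*} [Group G] (g : G) (H : Subgroup G) : Subgroup G :=
  H.map (MulAut.conj g).toMonoidHom

/-- The finite list `R = [g₁, …, gₙ]` is a system of BNTCI representatives in `G` by `H`: whenever
`g⁻¹ H g ∩ H ≠ 1`, the element `g` lies in one of the double cosets `H gᵢ H`. -/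
def IsBNTCIReps {G : Type*} [Group G] (H : Subgroup G) (R : List G) : Prop :=
  ∀ g : G, conjBy g⁻¹ H ⊓ H ≠ ⊥ → ∃ r ∈ R, g ∈ DoubleCoset.doubleCoset r (H : Set G) (H : Set G)

/-- `h` is a root element of `G`: it is not a proper power, that is, not of the form `a ^ n` with
`n ≥ 2`. (In particular `1` is not a root element, and negative exponents are covered by replacing
`a` by `a⁻¹`.) -/
def IsRootElement {G : Type*} [Group G] (h : G) : Prop :=
  ∀ (a : G) (n : ℕ), 2 ≤ n → a ^ n ≠ h

/-- Words (not necessarily reduced) in the letters `x` (coded as `(x, true)`) and `x⁻¹`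
(coded as `(x, false)`), as in the definition of `FreeGroup`. The element of `FreeGroup X`
represented by the word `w` is `FreeGroup.mk w`. -/
abbrev GroupWord (X : Type*) : Type _ := List (X × Bool)

/-- The subgroup of the free group on `X` generated by a finite list of words. -/
def wordSubgroup {X : Type*} (S : List (GroupWord X)) : Subgroup (FreeGroup X) :=
  Subgroup.closure {x | ∃ w ∈ S, FreeGroup.mk w = x}

/-!
Write `H^g = g⁻¹ H g`, and let `K = g H g⁻¹ ∩ H`.

**The criterion.** If `g` runs through a system of BNTCI representatives, then `H` is conjugacy stable
if and only if for each `g` there is one `b ∈ H` that conjugates the elements of `K` as `g` does. The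
implication from right to left is `conjugacyStable_of_forall_reps`. For the other one
(`ConjugacyStable.exists_root`) note that stability gives, for each `u ∈ K`, an element `c` of the
centralizer of `u` with `c g ∈ H`. Centralizers of nontrivial elements of a free group are cyclic, by
the Nielsen–Schreier theorem. If `K` is not commutative it contains an element that is not a proper
power in the whole free group (`FreeGroup.exists_isRootElement_of_not_commute`, by a periodicity
argument on words); such an element generates its own centralizer, so `c ∈ H` and hence `g ∈ H`.
Otherwise `K` is generated by a power `rⁿ` of a root element `r`, and `n = 1` again gives `g ∈ H`.

**Representatives and intersections.** Let `P` be the set of prefixes of the given generators of `H`.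
Every prefix of a reduced word representing an element of `H` lies in `H P`
(`pathIn_toWord_of_mem_wordSubgroup`); this is the statement that the core of the Schreier graph is
covered by the generators, and it replaces the folding of graphs. It follows that the elements
`p q⁻¹` with `p, q ∈ P` form a system of BNTCI representatives, and, by a pigeonhole argument on pairs
of cosets, that `K` is generated by its elements of explicitly bounded length.

**Membership.** To decide whether a word lies in `H`, saturate the set of generators under those
products `x⁻¹ y` that are short compared with the generators and the word. By `mem_of_saturated` the
result contains all sufficiently short elements of `H`: modulo the relation given by the saturated
set, letters act on a ball of the free group by partial injections, which extend to permutations.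

**Decidability.** If a suitable `b` exists, there is one of bounded length
(`ConjugacyStable.exists_short_conj`), so conjugacy stability is a bounded search using the membership
test. All procedures are primitive recursive.
-/

theorem IsRootElement.conj {G : Type*} [Group G] {w : G} (h : IsRootElement w) (p : G) :
    IsRootElement (p * w * p⁻¹) := by
  intro a n hn ha
  refine h (p⁻¹ * a * p) n hn ?_
  have : (p⁻¹ * a * p⁻¹⁻¹) ^ n = p⁻¹ * a ^ n * p⁻¹⁻¹ := conj_pow
  rw [inv_inv] at this
  rw [this, ha]; group

namespace FreeGroup

/-! ### Centralizers and powers in free groups -/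

section Centralizers

variable {α : Type*}

/-- A free group on at least two generators has trivial centre: if `x` is a generator other than
the first letter of `z`, then no cancellation occurs in `x z`, and `x z` and `z x` have different
first letters. -/
theorem subsingleton_of_central {z : FreeGroup α} (hz : z ≠ 1) (hc : ∀ x, Commute z x) :
    Subsingleton α := by
  classical
  have key : ∀ x : α, ∀ y ∈ z.toWord.head?, x = y.1 := by
    intro x y hy
    by_contra hxy
    obtain ⟨L, hL⟩ : ∃ L, z.toWord = y :: L := by
      cases h : z.toWord with
      | nil => simp [h] at hy
      | cons a L => simp [h] at hy; exact ⟨L, by rw [hy]⟩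
    have hred : IsReduced ((x, true) :: y :: L) := by
      rw [isReduced_cons_cons]
      exact ⟨fun h => absurd h hxy, hL ▸ isReduced_toWord⟩
    have h1 : (of x * z).toWord = (x, true) :: y :: L := by
      rw [toWord_mul, toWord_of, hL]
      exact hred.reduce_eq
    have h2 := toWord_mul_sublist z (of x)
    rw [(hc (of x)).eq, h1, hL, toWord_of] at h2
    have h3 := h2.eq_of_length (by simp)
    simp only [List.cons_append, List.cons.injEq] at h3
    exact hxy (by rw [← h3.1])
  obtain ⟨y, L, hL⟩ : ∃ y L, z.toWord = y :: L := by
    cases h : z.toWord with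
    | nil => exact absurd (toWord_eq_nil_iff.1 h) hz
    | cons a L => exact ⟨a, L, rfl⟩
  exact ⟨fun a b => by rw [key a y (by simp [hL]), key b y (by simp [hL])]⟩

/-- Centralizers of nontrivial elements of a free group are cyclic: by the Nielsen–Schreier theorem
such a centralizer is free, and it has a nontrivial centre. -/
theorem exists_centralizer_eq_zpowers {u : FreeGroup α} (hu : u ≠ 1) :
    ∃ r : FreeGroup α, ∀ c, Commute c u ↔ c ∈ Subgroup.zpowers r := by
  let C := Subgroup.centralizer {u}
  have huC : u ∈ C := by simp [C, Subgroup.mem_centralizer_singleton_iff]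
  obtain ⟨ι, ⟨b⟩⟩ := IsFreeGroup.nonempty_basis (G := C)
  have hz : b.repr ⟨u, huC⟩ ≠ 1 := by
    intro h
    apply hu
    rw [map_eq_one_iff _ b.repr.injective] at h
    exact congrArg Subtype.val h
  have hsub : Subsingleton ι := by
    refine subsingleton_of_central hz fun x => ?_
    obtain ⟨y, rfl⟩ := b.repr.surjective x
    refine Commute.map (f := b.repr.toMonoidHom) ?_
    have := y.2
    simp only [C, Subgroup.mem_centralizer_singleton_iff] at this
    exact Subtype.ext this.symm
  have hcyc : IsCyclic (FreeGroup ι) := by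
    rcases isEmpty_or_nonempty ι with h | ⟨⟨i⟩⟩
    · infer_instance
    · have : Unique ι := ⟨⟨i⟩, fun _ => Subsingleton.elim _ _⟩
      infer_instance
  have : IsCyclic C := isCyclic_of_surjective b.repr.symm b.repr.symm.surjective
  obtain ⟨r, hr⟩ := IsCyclic.exists_generator (α := C)
  refine ⟨r, fun c => ⟨fun hc => ?_, fun hc => ?_⟩⟩
  · have hcC : c ∈ C := by
      rw [Subgroup.mem_centralizer_singleton_iff]; exact hc.eq
    obtain ⟨k, hk⟩ := hr ⟨c, hcC⟩
    exact ⟨k, by simpa using congrArg Subtype.val hk⟩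
  · have hrC := r.2
    rw [Subgroup.mem_centralizer_singleton_iff] at hrC
    obtain ⟨k, rfl⟩ := hc
    exact Commute.zpow_left (show Commute (r : FreeGroup α) u from hrC) k

theorem exists_root_centralizer {u : FreeGroup α} (hu : u ≠ 1) :
    ∃ r : FreeGroup α, IsRootElement r ∧ ∀ c, Commute c u ↔ c ∈ Subgroup.zpowers r := by
  obtain ⟨r, hr⟩ := exists_centralizer_eq_zpowers hu
  obtain ⟨m, hm⟩ := (hr u).1 (Commute.refl u)
  have hr1 : r ≠ 1 := by
    rintro rfl
    exact hu (by simpa using hm.symm)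
  refine ⟨r, fun a n hn han => ?_, hr⟩
  have hau : Commute a u := by
    rw [← hm, ← han]
    exact ((Commute.refl a).pow_right n).zpow_right m
  obtain ⟨k, hk⟩ := (hr a).1 hau
  have h1 : r ^ (k * n) = r ^ (1 : ℤ) := by
    rw [zpow_mul, zpow_one, zpow_natCast]
    change (fun x : ℤ => r ^ x) k ^ n = r
    rw [hk, han]
  have h2 : k * n = 1 := by
    by_contra hne
    have h3 : r ^ (k * n - 1) = 1 := by rw [zpow_sub, h1]; simp
    exact hr1 ((IsMulTorsionFree.zpow_eq_one_iff_left (sub_ne_zero.2 hne)).1 h3)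
  have := Int.eq_one_or_neg_one_of_mul_eq_one' h2
  omega

/-- Nontrivial elements of a free group are not conjugate to their inverses. -/
theorem eq_one_of_isConj_inv {a : FreeGroup α} (h : IsConj a a⁻¹) : a = 1 := by
  obtain ⟨x, hx⟩ := isConj_iff.1 h
  have h2 : Commute (x ^ 2) a := by
    have h1 : x * a = a⁻¹ * x := by rw [← hx]; group
    have h3 : x * a⁻¹ = a * x := by
      have : x * a⁻¹ * x⁻¹ = a := by
        have := congrArg (·⁻¹) hx
        simpa [mul_assoc] using this
      calc x * a⁻¹ = x * a⁻¹ * x⁻¹ * x := by group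
        _ = a * x := by rw [this]
    change x ^ 2 * a = a * x ^ 2
    rw [pow_two, mul_assoc, h1, ← mul_assoc, h3, mul_assoc]
  have hxa : Commute x a := by
    by_cases hx1 : x = 1
    · subst hx1; exact Commute.one_left a
    · have : x ^ 2 ≠ 1 := fun h => hx1 ((pow_eq_one_iff_left two_ne_zero).1 h)
      obtain ⟨r, hr⟩ := exists_centralizer_eq_zpowers this
      obtain ⟨i, rfl⟩ := (hr x).1 ((Commute.refl x).pow_right 2)
      obtain ⟨j, rfl⟩ := (hr a).1 h2.symm
      exact ((Commute.refl r).zpow_zpow i j)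
  have : a = a⁻¹ := by
    rw [← hx, hxa.eq]; group
  have h3 : a ^ 2 = 1 := by
    rw [pow_two]; nth_rewrite 2 [this]; simp
  exact (pow_eq_one_iff_left two_ne_zero).1 h3

theorem norm_pow_le_norm_pow [DecidableEq α] (r : FreeGroup α) {m n : ℕ} (h : m ≤ n) :
    norm (r ^ m) ≤ norm (r ^ n) := by
  simp only [norm, toWord_pow, reduceCyclically.reduce_flatten_replicate isReduced_toWord]
  rcases Nat.eq_zero_or_pos m with rfl | hm
  · simp
  · have hn : n ≠ 0 := by omega
    simp only [hm.ne', hn, if_false, List.length_append, List.length_flatten, List.map_replicate,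
      List.sum_replicate, smul_eq_mul]
    gcongr

theorem norm_zpow [DecidableEq α] (r : FreeGroup α) (k : ℤ) :
    norm (r ^ k) = norm (r ^ k.natAbs) := by
  rcases Int.natAbs_eq k with h | h
  · nth_rewrite 1 [h]; rw [zpow_natCast]
  · nth_rewrite 1 [h]; rw [zpow_neg, norm_inv_eq, zpow_natCast]

end Centralizers

/-! ### Elements that are not proper powers -/

section Words

variable {α : Type*}

/-- The product of two reduced words is computed by cancelling a suffix of the first against a
prefix of the second. -/
theorem exists_cancellation {L₁ L₂ : List (α × Bool)} (h₁ : IsReduced L₁) (h₂ : IsReduced L₂) :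
    ∃ P Q R, L₁ = P ++ Q ∧ L₂ = invRev Q ++ R ∧ IsReduced (P ++ R) := by
  classical
  induction L₁ using List.reverseRecOn generalizing L₂ with
  | nil => exact ⟨[], [], L₂, by simp, by simp, by simpa using h₂⟩
  | append_singleton L x ih =>
    have hL : IsReduced L := h₁.infix ⟨[], [x], by simp⟩
    cases L₂ with
    | nil => exact ⟨L ++ [x], [], [], by simp, by simp, by simpa using h₁⟩
    | cons y L₂ =>
      by_cases hxy : x.1 = y.1 → x.2 = y.2
      · refine ⟨L ++ [x], [], y :: L₂, by simp, by simp, ?_⟩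
        refine List.isChain_append.2 ⟨h₁, h₂, ?_⟩
        intro a ha b hb
        simp at ha hb
        subst ha; subst hb; exact hxy
      · obtain ⟨P, Q, R, h3, h4, h5⟩ := ih (L₂ := L₂) hL (h₂.infix ⟨[y], [], by simp⟩)
        refine ⟨P, Q ++ [x], R, by simp [h3], ?_, h5⟩
        push Not at hxy
        have : y = (x.1, !x.2) := by
          ext
          · exact hxy.1.symm
          · simpa using (Bool.eq_not_of_ne hxy.2.symm)
        simp [invRev, this, h4]

/-- `wordPow A n` is the `n`-fold concatenation of the word `A`. -/
abbrev wordPow (A : List (α × Bool)) (n : ℕ) : List (α × Bool) := (List.replicate n A).flatten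

theorem append_prefix_wordPow {A S : List (α × Bool)} {n : ℕ} (h : S <+: wordPow A n) :
    A ++ S <+: wordPow A (n + 1) := by
  simp only [wordPow, List.replicate_succ, List.flatten_cons]
  exact (List.prefix_append_right_inj A).2 h

theorem wordPow_prefix_succ (A : List (α × Bool)) (n : ℕ) :
    wordPow A n <+: wordPow A (n + 1) := by
  simp only [wordPow, List.replicate_succ', List.flatten_append]
  exact List.prefix_append _ _

theorem eq_of_prefix_of_prefix {S T W : List (α × Bool)} (hS : S <+: W) (hT : T <+: W)
    (h : S.length = T.length) : S = T :=
  (List.prefix_of_prefix_length_le hS hT h.le).eq_of_length h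

theorem length_wordPow (A : List (α × Bool)) (n : ℕ) : (wordPow A n).length = n * A.length := by
  simp [wordPow]

/-- A factor of length `|A|` of a power of `A` is a cyclic permutation of `A`. -/
theorem isConj_of_factor_wordPow {A S T U : List (α × Bool)} {n : ℕ}
    (h : wordPow A n = S ++ T ++ U) (hT : T.length = A.length) : IsConj (mk T) (mk A) := by
  have h1 : S ++ T <+: wordPow A (n + 1) :=
    (h ▸ List.prefix_append _ _ : S ++ T <+: wordPow A n).trans (wordPow_prefix_succ A n)
  have h2 : A ++ S <+: wordPow A (n + 1) :=
    append_prefix_wordPow (h ▸ ⟨T ++ U, by simp⟩)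
  have h3 : S ++ T = A ++ S := eq_of_prefix_of_prefix h1 h2 (by simp [hT]; omega)
  rw [isConj_iff]
  refine ⟨mk S, ?_⟩
  have := congrArg (mk (α := α)) h3
  rw [← mul_mk, ← mul_mk] at this
  rw [this]; group

/-- A weak form of the Fine–Wilf periodicity theorem: if powers of `A` and `R` have a common prefix
of length `|A| + |R|`, this prefix is both `A R` and `R A`. -/
theorem commute_of_common_prefix {A R W : List (α × Bool)} {m n : ℕ} (hA : W <+: wordPow A m)
    (hR : W <+: wordPow R n) (hW : W.length = A.length + R.length) : Commute (mk A) (mk R) := by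
  have key : ∀ {A R : List (α × Bool)} {m n : ℕ}, W <+: wordPow A m → W <+: wordPow R n →
      W.length = A.length + R.length → W = A ++ R := by
    intro A R m n hA hR hW
    rcases eq_or_ne R [] with rfl | hR0
    · rcases eq_or_ne A [] with rfl | hA0
      · simpa using hW
      · have hm : A <+: wordPow A (m + 1) := by simp [wordPow, List.replicate_succ]
        simpa using eq_of_prefix_of_prefix (hA.trans (wordPow_prefix_succ A m)) hm (by simpa using hW)
    · have hRn : R <+: wordPow R (n + 1) := by simp [wordPow, List.replicate_succ]
      have hRW : R <+: W :=
        List.prefix_of_prefix_length_le hRn (hR.trans (wordPow_prefix_succ R n)) (by omega)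
      exact eq_of_prefix_of_prefix (hA.trans (wordPow_prefix_succ A m))
        (append_prefix_wordPow (hRW.trans hA)) (by simpa using hW)
  have h := (key hA hR hW).symm.trans (key hR hA (by omega))
  change mk A * mk R = mk R * mk A
  rw [mul_mk, mul_mk, h]

theorem head?_wordPow (A : List (α × Bool)) {n : ℕ} (hn : n ≠ 0) :
    (wordPow A n).head? = A.head? := List.head?_flatten_replicate hn A

theorem getLast?_wordPow (A : List (α × Bool)) {n : ℕ} (hn : n ≠ 0) :
    (wordPow A n).getLast? = A.getLast? := List.getLast?_flatten_replicate hn A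

/-- For a nonempty cyclically reduced word `A` and any `b`, some `Aᴺ b Aᴺ` is represented by a
reduced word with the same first and the same last letter as `A`: otherwise a power of `A` and a
power of its inverse would overlap in a word of length `|A|`, and `A` would be conjugate to its
inverse. -/
theorem exists_reduced_between_powers {A : List (α × Bool)} (hA : IsCyclicallyReduced A)
    (hA0 : A ≠ []) (b : FreeGroup α) :
    ∃ (N : ℕ) (D : List (α × Bool)), mk D = mk A ^ N * b * mk A ^ N ∧ IsReduced D ∧
      D.head? = A.head? ∧ D.getLast? = A.getLast? := by
  classical
  set B := b.toWord with hB
  have hApos : 0 < A.length := List.length_pos_iff.2 hA0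
  -- the power is long enough not to be consumed by cancellation against `b`
  set N := B.length + 1 with hN
  have hCred : IsReduced (wordPow A N) := (hA.flatten_replicate N).isReduced
  obtain ⟨P, Q, R, h1, h2, h3⟩ := exists_cancellation hCred (isReduced_toWord (x := b))
  obtain ⟨P', Q', R', h4, h5, h6⟩ := exists_cancellation h3 hCred
  have lC : (wordPow A N).length = N * A.length := length_wordPow A N
  have l1 := congrArg List.length h1
  have l2 := congrArg List.length h2
  have l4 := congrArg List.length h4
  have l5 := congrArg List.length h5
  simp only [List.length_append, invRev_length, ← hB] at l1 l2 l4 l5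
  rw [lC] at l1 l5
  have hNA : B.length + A.length ≤ N * A.length := by
    rw [hN, add_mul, one_mul]
    have := Nat.le_mul_of_pos_right B.length hApos
    omega
  -- If the second cancellation reached `|A|` letters into the first power, then a cyclic permutation
  -- `T` of `A` and its inverse would both be factors of `A ^ N`.
  have hQ' : Q'.length < R.length + A.length := by
    by_contra hlt
    push Not at hlt
    obtain ⟨E, hE1, hE2⟩ : ∃ E, P = P' ++ E ∧ Q' = E ++ R := by
      rcases List.append_eq_append_iff.1 h4 with ⟨E, hE1, hE2⟩ | ⟨E, hE1, hE2⟩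
      · have := congrArg List.length hE2
        simp at this
        omega
      · exact ⟨E, hE1, hE2⟩
    have lE : A.length ≤ E.length := by
      have := congrArg List.length hE2
      simp at this; omega
    set E' := E.take (E.length - A.length)
    set T := E.drop (E.length - A.length) with hT
    have hET : E = E' ++ T := (List.take_append_drop _ _).symm
    have lT : T.length = A.length := by simp [hT]; omega
    have c1 : IsConj (mk T) (mk A) := by
      refine isConj_of_factor_wordPow (n := N) (S := P' ++ E') (U := Q) ?_ lT
      rw [h1, hE1, hET]; simp
    have c2 : IsConj (mk (invRev T)) (mk A) := by
      refine isConj_of_factor_wordPow (n := N) (S := invRev R) (U := invRev E' ++ R') ?_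
        (by simpa using lT)
      rw [h5, hE2, hET]; simp [invRev_append]
    rw [← inv_mk] at c2
    have c3 : IsConj (mk T) (mk T)⁻¹ := c1.trans c2.symm
    have c4 := eq_one_of_isConj_inv c3
    rw [c4] at c1
    have c5 : mk A = 1 := isConj_one_right.1 c1
    have c6 := congrArg toWord c5
    rw [toWord_mk, hA.isReduced.reduce_eq, toWord_one] at c6
    exact hA0 c6
  have hP : P ≠ [] := by
    rintro rfl
    simp at l1; omega
  have hP' : P' ≠ [] := by
    rintro rfl
    simp at l4; omega
  have hR' : R' ≠ [] := by
    rintro rfl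
    simp at l5; omega
  refine ⟨N, P' ++ R', ?_, h6, ?_, ?_⟩
  · have e1 : mk A ^ N = mk P * mk Q := by rw [pow_mk, ← wordPow, h1, mul_mk]
    have e2 : b = (mk Q)⁻¹ * mk R := by rw [inv_mk, mul_mk, ← h2, mk_toWord]
    have e3 : mk P * mk R = mk P' * mk Q' := by rw [mul_mk, mul_mk, h4]
    have e4 : mk A ^ N = (mk Q')⁻¹ * mk R' := by rw [pow_mk, ← wordPow, h5, inv_mk, mul_mk]
    calc mk (P' ++ R') = (mk P' * mk Q') * ((mk Q')⁻¹ * mk R') := by rw [← mul_mk]; group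
      _ = (mk P * mk Q) * ((mk Q)⁻¹ * mk R) * ((mk Q')⁻¹ * mk R') := by rw [← e3]; group
      _ = mk A ^ N * b * mk A ^ N := by rw [← e1, ← e2, ← e4]
  · have a1 : (P' ++ R').head? = P'.head? := List.head?_append_of_ne_nil _ hP'
    have a2 : (P' ++ Q').head? = P'.head? := List.head?_append_of_ne_nil _ hP'
    have a3 : (P ++ R).head? = P.head? := List.head?_append_of_ne_nil _ hP
    have a4 : (P ++ Q).head? = P.head? := List.head?_append_of_ne_nil _ hP
    rw [a1, ← a2, ← h4, a3, ← a4, ← h1]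
    exact head?_wordPow A (by omega)
  · have a1 : (P' ++ R').getLast? = R'.getLast? := List.getLast?_append_of_ne_nil _ hR'
    have a2 : (invRev Q' ++ R').getLast? = R'.getLast? := List.getLast?_append_of_ne_nil _ hR'
    rw [a1, ← a2, ← h5]
    exact getLast?_wordPow A (by omega)

/-- If the cyclically reduced word `A` does not commute with `b`, then `Aᵏ (Aᴺ b Aᴺ)` is not a proper
power for large `k`: an `n`-th root with `n ≥ 2` is at most half as long, so it shares with `A` a
periodic prefix long enough to force both to commute. -/
theorem exists_isRootElement_of_cyclicallyReduced {A : List (α × Bool)} (hA : IsCyclicallyReduced A)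
    {b : FreeGroup α} (hab : ¬ Commute (mk A) b) :
    ∃ w ∈ Subgroup.closure {mk A, b}, IsRootElement w := by
  classical
  have hA0 : A ≠ [] := by
    rintro rfl
    exact hab (by rw [← one_eq_mk]; exact Commute.one_left b)
  have hApos : 0 < A.length := List.length_pos_iff.2 hA0
  obtain ⟨N, D, hD, hDred, hDh, hDl⟩ := exists_reduced_between_powers hA hA0 b
  -- then `|A| + |ρ| ≤ k |A|` whenever `2 |ρ| ≤ k |A| + |D|`
  set k := D.length + 2 with hk
  have hk0 : k ≠ 0 := by omega
  have hD0 : D ≠ [] := by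
    rintro rfl
    simp at hDh
    exact hA0 (List.head?_eq_none_iff.1 hDh.symm)
  have hW : IsCyclicallyReduced (wordPow A k ++ D) := by
    refine ⟨List.isChain_append.2 ⟨(hA.flatten_replicate k).isReduced, hDred, ?_⟩, ?_⟩
    · intro x hx y hy
      rw [hDh] at hy
      have := getLast?_wordPow A hk0
      exact hA.2 x (this ▸ hx) y hy
    · intro x hx y hy
      have a1 : (wordPow A k ++ D).getLast? = D.getLast? := List.getLast?_append_of_ne_nil _ hD0
      have hne : wordPow A k ≠ [] := by
        rw [← List.length_pos_iff, length_wordPow]; positivity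
      have a2 : (wordPow A k ++ D).head? = (wordPow A k).head? := 
        List.head?_append_of_ne_nil _ hne
      rw [a1, hDl] at hx
      rw [a2, head?_wordPow A hk0] at hy
      exact hA.2 x hx y hy
  refine ⟨mk (wordPow A k ++ D), ?_, ?_⟩
  · rw [← mul_mk, ← pow_mk, hD]
    have ha : mk A ∈ Subgroup.closure {mk A, b} := Subgroup.subset_closure (by simp)
    have hb : b ∈ Subgroup.closure {mk A, b} := Subgroup.subset_closure (by simp)
    exact mul_mem (pow_mem ha _) (mul_mem (mul_mem (pow_mem ha _) hb) (pow_mem ha _))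
  · intro r n hn hr
    have h1 := congrArg toWord hr
    have hn0 : n ≠ 0 := by omega
    rw [toWord_mk, hW.isReduced.reduce_eq, toWord_pow,
      reduceCyclically.reduce_flatten_replicate isReduced_toWord, if_neg hn0] at h1
    set c := reduceCyclically.conjugator r.toWord with hc
    set ρ := reduceCyclically r.toWord with hρ
    -- a root of a cyclically reduced word is cyclically reduced
    have hc0 : c = [] := by
      cases hcc : c with
      | nil => rfl
      | cons x l =>
        exfalso
        rw [hcc] at h1
        have hh : x ∈ (wordPow A k ++ D).head? := by rw [← h1]; simp
        have hl : (x.1, !x.2) ∈ (wordPow A k ++ D).getLast? := by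
          
          have e : invRev (x :: l) = invRev l ++ [(x.1, !x.2)] := by simp [invRev]
          rw [← h1, e, ← List.append_assoc, List.getLast?_concat]
          rfl
        have := hW.2 _ hl _ hh rfl
        simp at this
    have hrρ : r = mk ρ := by
      have := reduceCyclically.conj_conjugator_reduceCyclically r.toWord
      rw [← hc, ← hρ, hc0] at this
      simp at this
      rw [this, mk_toWord]
    rw [hc0] at h1
    simp only [List.nil_append, invRev_empty, List.append_nil] at h1
    have hlen := congrArg List.length h1
    rw [List.length_append] at hlen
    have hlen' : n * ρ.length = k * A.length + D.length := by
      rw [← length_wordPow A k, ← hlen]; simp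
    have hle : A.length + ρ.length ≤ k * A.length := by
      have e1 : 2 * ρ.length ≤ n * ρ.length := Nat.mul_le_mul_right _ hn
      have e2 : D.length ≤ D.length * A.length := Nat.le_mul_of_pos_right _ hApos
      have e3 : k * A.length = D.length * A.length + 2 * A.length := by rw [hk]; ring
      omega
    have hcomm : Commute (mk A) (mk ρ) := by
      refine commute_of_common_prefix (m := k) (n := n)
        (W := (wordPow A k).take (A.length + ρ.length)) (List.take_prefix _ _) ?_ ?_
      · refine (List.take_prefix _ _).trans ?_
        change _ <+: (List.replicate n ρ).flatten
        rw [h1]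
        exact List.prefix_append _ _
      · rw [List.length_take, length_wordPow]; omega
    apply hab
    rw [← hrρ] at hcomm
    have h2 : Commute (mk A) (mk A ^ k * (mk A ^ N * b * mk A ^ N)) := by
      rw [← hD, pow_mk, mul_mk, ← hr]
      exact hcomm.pow_right n
    have hp : ∀ i, Commute (mk A) ((mk A ^ i)⁻¹) := fun i =>
      ((Commute.refl (mk A)).pow_right i).inv_right
    have h3 := (((hp N).mul_right ((hp k).mul_right h2))).mul_right (hp N)
    have e : (mk A ^ N)⁻¹ * ((mk A ^ k)⁻¹ * (mk A ^ k * (mk A ^ N * b * mk A ^ N))) * (mk A ^ N)⁻¹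
        = b := by group
    rwa [e] at h3

/-- Every element of a free group is conjugate to one given by a cyclically reduced word. -/
theorem exists_conj_cyclicallyReduced (a : FreeGroup α) :
    ∃ (p : FreeGroup α) (A : List (α × Bool)), IsCyclicallyReduced A ∧ a = p * mk A * p⁻¹ := by
  classical
  refine ⟨mk (reduceCyclically.conjugator a.toWord), reduceCyclically a.toWord,
    reduceCyclically.isCyclicallyReduced isReduced_toWord, ?_⟩
  rw [inv_mk, mul_mk, mul_mk, reduceCyclically.conj_conjugator_reduceCyclically, mk_toWord]

/-- A noncommutative subgroup of a free group contains an element that is not a proper power in the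
whole group. -/
theorem exists_isRootElement_of_not_commute {a b : FreeGroup α} (hab : ¬ Commute a b) :
    ∃ w ∈ Subgroup.closure {a, b}, IsRootElement w := by
  obtain ⟨p, A, hA, rfl⟩ := exists_conj_cyclicallyReduced a
  have h : ¬ Commute (mk A) (p⁻¹ * b * p) := by
    intro h
    apply hab
    have := h.map (MulAut.conj p).toMonoidHom
    have e : p * (p⁻¹ * b * p) * p⁻¹ = b := by group
    simpa [e] using this
  obtain ⟨w, hw, hroot⟩ := exists_isRootElement_of_cyclicallyReduced hA h
  refine ⟨p * w * p⁻¹, ?_, hroot.conj p⟩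
  have hle : Subgroup.closure {mk A, p⁻¹ * b * p} ≤
      (Subgroup.closure {p * mk A * p⁻¹, b}).comap (MulAut.conj p).toMonoidHom := by
    rw [Subgroup.closure_le]
    rintro x (rfl | rfl)
    · exact Subgroup.subset_closure (by simp)
    · refine Subgroup.subset_closure ?_
      right
      simp [mul_assoc]
  simpa using hle hw

end Words

end FreeGroup

/-! ### The criterion for conjugacy stability -/

section Criterion

open FreeGroup

theorem mem_conjBy {G : Type*} [Group G] {g x : G} {H : Subgroup G} :
    x ∈ conjBy g H ↔ g⁻¹ * x * g ∈ H := by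
  constructor
  · rintro ⟨y, hy, rfl⟩
    have : g⁻¹ * (g * y * g⁻¹) * g = y := by group
    simpa [this] using hy
  · intro h
    exact ⟨_, h, by simp [mul_assoc]⟩

/-- Conjugacy stability with the conjugating elements made explicit. -/
theorem conjugacyStable_iff {G : Type*} [Group G] {H : Subgroup G} :
    ConjugacyStable H ↔
      ∀ u ∈ H, ∀ f : G, f⁻¹ * u * f ∈ H → ∃ b ∈ H, b⁻¹ * u * b = f⁻¹ * u * f := by
  constructor
  · intro h u hu f hf
    obtain ⟨c, hc⟩ := isConj_iff.1 (h ⟨u, hu⟩ ⟨_, hf⟩ (isConj_iff.2 ⟨f⁻¹, by simp⟩))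
    exact ⟨c⁻¹, inv_mem c.2, by simpa using congrArg Subtype.val hc⟩
  · intro h u v huv
    obtain ⟨c, hc⟩ := isConj_iff.1 huv
    obtain ⟨b, hb, hbu⟩ := h u u.2 c⁻¹ (by simp [hc])
    refine isConj_iff.2 ⟨⟨b⁻¹, inv_mem hb⟩, Subtype.ext ?_⟩
    simpa [hc] using hbu

/-- A subgroup is conjugacy stable as soon as, for each `g` in a system of BNTCI representatives,
conjugation by `g⁻¹` agrees on `g H g⁻¹ ∩ H` with conjugation by an element of `H`. -/
theorem conjugacyStable_of_forall_reps {G : Type*} [Group G] {H : Subgroup G} {R : List G}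
    (hR : IsBNTCIReps H R)
    (h : ∀ g ∈ R, ∃ b ∈ H, ∀ u ∈ conjBy g H ⊓ H, b⁻¹ * u * b = g⁻¹ * u * g) :
    ConjugacyStable H := by
  rw [conjugacyStable_iff]
  intro u hu f hf
  by_cases hu1 : u = 1
  · exact ⟨1, one_mem H, by simp [hu1]⟩
  have hne : conjBy f⁻¹ H ⊓ H ≠ ⊥ := by
    rw [Subgroup.ne_bot_iff_exists_ne_one]
    refine ⟨⟨f⁻¹ * u * f, mem_conjBy.2 ?_, hf⟩, fun he => hu1 ?_⟩
    · have : f⁻¹⁻¹ * (f⁻¹ * u * f) * f⁻¹ = u := by group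
      rwa [this]
    · have he' : f⁻¹ * u * f = 1 := congrArg Subtype.val he
      calc u = f * (f⁻¹ * u * f) * f⁻¹ := by group
        _ = 1 := by rw [he']; group
  obtain ⟨g, hg, hfg⟩ := hR f hne
  obtain ⟨x, hx, y, hy, rfl⟩ := DoubleCoset.mem_doubleCoset.1 hfg
  rw [SetLike.mem_coe] at hx hy
  obtain ⟨b, hb, hbu⟩ := h g hg
  have hxu : x⁻¹ * u * x ∈ H := mul_mem (mul_mem (inv_mem hx) hu) hx
  have hK : x⁻¹ * u * x ∈ conjBy g H ⊓ H := by
    refine ⟨mem_conjBy.2 ?_, hxu⟩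
    have : g⁻¹ * (x⁻¹ * u * x) * g = y * ((x * g * y)⁻¹ * u * (x * g * y)) * y⁻¹ := by group
    rw [this]
    exact mul_mem (mul_mem hy hf) (inv_mem hy)
  refine ⟨x * b * y, mul_mem (mul_mem hx hb) hy, ?_⟩
  calc (x * b * y)⁻¹ * u * (x * b * y) = y⁻¹ * (b⁻¹ * (x⁻¹ * u * x) * b) * y := by group
    _ = y⁻¹ * (g⁻¹ * (x⁻¹ * u * x) * g) * y := by rw [hbu _ hK]
    _ = (x * g * y)⁻¹ * u * (x * g * y) := by group

theorem conj_eq_conj_of_mem_zpowers {G : Type*} [Group G] {h c g u : G} {n : ℕ}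
    (hc : c ∈ Subgroup.zpowers h) (hu : u ∈ Subgroup.zpowers (h ^ n)) :
    (c * g)⁻¹ * u * (c * g) = g⁻¹ * u * g := by
  obtain ⟨j, rfl⟩ := hc
  obtain ⟨k, rfl⟩ := hu
  have h1 : Commute (h ^ j) ((h ^ n) ^ k) :=
    (((Commute.refl h).pow_right n).zpow_right k).zpow_left j
  change (h ^ j * g)⁻¹ * (h ^ n) ^ k * (h ^ j * g) = g⁻¹ * (h ^ n) ^ k * g
  calc (h ^ j * g)⁻¹ * (h ^ n) ^ k * (h ^ j * g)
      = g⁻¹ * (h ^ j)⁻¹ * ((h ^ n) ^ k * h ^ j) * g := by simp only [mul_inv_rev, mul_assoc]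
    _ = g⁻¹ * (h ^ n) ^ k * g := by rw [← h1.eq]; simp [mul_assoc]

variable {α : Type*}

/-- In a conjugacy stable subgroup every element of `K = g H g⁻¹ ∩ H` commutes with an element of
`H g⁻¹`. If `K` were noncommutative it would contain an element generating its own centralizer,
which would put `g` in `H`. -/
theorem ConjugacyStable.exists_root {H : Subgroup (FreeGroup α)} (hst : ConjugacyStable H)
    {g : FreeGroup α} (hg : g ∉ H) (hne : conjBy g H ⊓ H ≠ ⊥) :
    ∃ (h : FreeGroup α) (n : ℕ), IsRootElement h ∧ 2 ≤ n ∧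
      conjBy g H ⊓ H = Subgroup.zpowers (h ^ n) ∧ ∃ c ∈ Subgroup.zpowers h, c * g ∈ H := by
  set K := conjBy g H ⊓ H with hK
  have hcomm : ∀ u ∈ K, ∃ c, Commute c u ∧ c * g ∈ H := by
    intro u hu
    obtain ⟨b, hb, hbu⟩ := conjugacyStable_iff.1 hst u hu.2 g (mem_conjBy.1 hu.1)
    refine ⟨b * g⁻¹, ?_, by simpa using hb⟩
    change b * g⁻¹ * u = u * (b * g⁻¹)
    calc b * g⁻¹ * u = b * (g⁻¹ * u * g) * g⁻¹ := by group
      _ = u * (b * g⁻¹) := by rw [← hbu]; group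
  have hab : ∀ a ∈ K, ∀ b ∈ K, Commute a b := by
    intro a ha b hb
    by_contra hab
    obtain ⟨w, hw, hroot⟩ := exists_isRootElement_of_not_commute hab
    have hwK : w ∈ K := by
      refine (Subgroup.closure_le K).2 ?_ hw
      rintro x (rfl | rfl) <;> assumption
    have hw1 : w ≠ 1 := fun h1 => hroot 1 2 le_rfl (by simp [h1])
    obtain ⟨c, hc, hcg⟩ := hcomm w hwK
    obtain ⟨r, hr⟩ := exists_centralizer_eq_zpowers hw1
    obtain ⟨k, hk⟩ := (hr w).1 (Commute.refl w)
    change r ^ k = w at hk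
    have hk1 : k = 1 ∨ k = -1 := by
      by_contra hk1
      have hk0 : k ≠ 0 := by rintro rfl; exact hw1 (by simpa using hk.symm)
      rcases Int.natAbs_eq k with h | h
      · refine hroot r k.natAbs (by omega) ?_
        rw [← zpow_natCast, ← h, hk]
      · refine hroot r⁻¹ k.natAbs (by omega) ?_
        rw [← zpow_natCast, inv_zpow', ← h, hk]
    have hrH : r ∈ H := by
      rcases hk1 with rfl | rfl
      · rw [zpow_one] at hk; exact hk ▸ hwK.2
      · rw [zpow_neg_one] at hk
        exact inv_mem_iff.1 (hk ▸ hwK.2)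
    obtain ⟨j, rfl⟩ := (hr c).1 hc
    exact hg ((Subgroup.mul_mem_cancel_left H (zpow_mem hrH j)).1 hcg)
  obtain ⟨⟨u, huK⟩, hu1'⟩ := Subgroup.ne_bot_iff_exists_ne_one.1 hne
  have hu1 : u ≠ 1 := fun h => hu1' (Subtype.ext h)
  obtain ⟨r, hroot, hr⟩ := exists_root_centralizer hu1
  obtain ⟨n, hn⟩ : ∃ n : ℕ, K = Subgroup.zpowers (r ^ n) := by
    have hle : K ≤ Subgroup.zpowers r := fun x hx => (hr x).1 (hab x hx u huK)
    obtain ⟨v, hv⟩ := (Subgroup.isCyclic_iff_exists_zpowers_eq_top K).1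
      (isCyclic_of_injective (Subgroup.inclusion hle) (Subgroup.inclusion_injective hle))
    obtain ⟨k, hk⟩ := hle (hv ▸ Subgroup.mem_zpowers v)
    change r ^ k = v at hk
    refine ⟨k.natAbs, ?_⟩
    rw [← hv, ← hk]
    rcases Int.natAbs_eq k with h | h
    · nth_rewrite 1 [h]; rw [zpow_natCast]
    · nth_rewrite 1 [h]; rw [zpow_neg, Subgroup.zpowers_inv, zpow_natCast]
  have hn0 : n ≠ 0 := by
    rintro rfl
    exact hne (by rw [hn]; simp)
  have hrnK : r ^ n ∈ K := hn ▸ Subgroup.mem_zpowers _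
  obtain ⟨c, hc, hcg⟩ := hcomm (r ^ n) hrnK
  have hcr : c ∈ Subgroup.zpowers r := by
    refine (hr c).1 ?_
    obtain ⟨k, rfl⟩ := (hn ▸ huK : u ∈ Subgroup.zpowers (r ^ n))
    exact hc.zpow_right k
  refine ⟨r, n, hroot, ?_, hn, c, hcr, hcg⟩
  by_contra hlt
  obtain rfl : n = 1 := by omega
  have hrH : r ∈ H := by simpa using hrnK.2
  obtain ⟨j, rfl⟩ := hcr
  exact hg ((Subgroup.mul_mem_cancel_left H (zpow_mem hrH j)).1 hcg)

theorem exists_conj_eq_of_exists_root {H : Subgroup (FreeGroup α)} {g : FreeGroup α}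
    (h : g ∉ H → conjBy g H ⊓ H ≠ ⊥ →
      ∃ (h : FreeGroup α) (n : ℕ), IsRootElement h ∧ 2 ≤ n ∧
        conjBy g H ⊓ H = Subgroup.zpowers (h ^ n) ∧ ∃ c ∈ Subgroup.zpowers h, c * g ∈ H) :
    ∃ b ∈ H, ∀ u ∈ conjBy g H ⊓ H, b⁻¹ * u * b = g⁻¹ * u * g := by
  by_cases hg : g ∈ H
  · exact ⟨g, hg, fun _ _ => rfl⟩
  by_cases hne : conjBy g H ⊓ H = ⊥
  · refine ⟨1, one_mem H, fun u hu => ?_⟩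
    rw [hne, Subgroup.mem_bot] at hu
    simp [hu]
  obtain ⟨r, n, -, -, hK, c, hc, hcg⟩ := h hg hne
  exact ⟨c * g, hcg, fun u hu => conj_eq_conj_of_mem_zpowers hc (hK ▸ hu)⟩

/-- In a conjugacy stable subgroup, an element inducing on `g H g⁻¹ ∩ H` the same conjugation as `g`
can be found among the elements of bounded length: a multiple `rʲ g` may be shifted by powers of a
generator `rⁿ` of the intersection. -/
theorem ConjugacyStable.exists_short_conj [DecidableEq α] {H : Subgroup (FreeGroup α)}
    (hst : ConjugacyStable H) (g : FreeGroup α) {T : List (GroupWord α)}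
    (hT : wordSubgroup T = conjBy g H ⊓ H) {l : ℕ} (hl : ∀ t ∈ T, t.length ≤ l) :
    ∃ b ∈ H, norm b ≤ norm g + l ∧ ∀ u ∈ conjBy g H ⊓ H, b⁻¹ * u * b = g⁻¹ * u * g := by
  by_cases hg : g ∈ H
  · exact ⟨g, hg, by omega, fun _ _ => rfl⟩
  by_cases hne : conjBy g H ⊓ H = ⊥
  · refine ⟨1, one_mem H, by simp, fun u hu => ?_⟩
    rw [hne, Subgroup.mem_bot] at hu
    simp [hu]
  obtain ⟨r, n, -, hn, hK, c, ⟨j, hj⟩, hcg⟩ := hst.exists_root hg hne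
  obtain ⟨t, ht, ht1⟩ : ∃ t ∈ T, mk t ≠ 1 := by
    by_contra hall
    push Not at hall
    apply hne
    rw [← hT, eq_bot_iff]
    refine (Subgroup.closure_le _).2 ?_
    rintro x ⟨w, hw, rfl⟩
    exact hall w hw
  have htK : mk t ∈ Subgroup.zpowers (r ^ n) := by
    rw [← hK, ← hT]
    exact Subgroup.subset_closure ⟨t, ht, rfl⟩
  obtain ⟨k, hk⟩ := htK
  change (r ^ n) ^ k = mk t at hk
  change r ^ j = c at hj
  have hk0 : k ≠ 0 := by rintro rfl; exact ht1 (by simpa using hk.symm)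
  obtain ⟨m, hm⟩ := Int.eq_ofNat_of_zero_le (Int.emod_nonneg j (by omega : (n : ℤ) ≠ 0))
  have hmn : m < n := by
    have := Int.emod_lt_of_pos j (by omega : (0 : ℤ) < n)
    omega
  have hrn : r ^ n ∈ H := by
    have h1 : r ^ n ∈ conjBy g H ⊓ H := hK ▸ Subgroup.mem_zpowers _
    exact h1.2
  refine ⟨r ^ m * g, ?_, ?_, fun u hu =>
    conj_eq_conj_of_mem_zpowers ⟨m, by simp⟩ (hK ▸ hu)⟩
  · have h1 : r ^ m = ((r ^ n) ^ (j / n))⁻¹ * c := by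
      rw [← hj, ← zpow_natCast, ← hm, ← zpow_natCast r n, ← zpow_mul, ← zpow_neg, ← zpow_add]
      congr 1
      have := Int.emod_add_mul_ediv j n
      omega
    rw [h1, mul_assoc]
    exact mul_mem (inv_mem (zpow_mem hrn _)) hcg
  · have h1 : norm (r ^ m) ≤ l := by
      have h2 : m ≤ ((n : ℤ) * k).natAbs := by
        rw [Int.natAbs_mul, Int.natAbs_natCast]
        have := Nat.le_mul_of_pos_right n (Int.natAbs_pos.2 hk0)
        omega
      refine (norm_pow_le_norm_pow r h2).trans ?_
      rw [← FreeGroup.norm_zpow, zpow_mul, zpow_natCast, hk]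
      exact norm_mk_le.trans (hl t ht)
    have := norm_mul_le (r ^ m) g
    omega

end Criterion

/-! ### Cosets visited by reduced words, representatives and intersections -/

section Core

open FreeGroup

variable {α : Type*}

/-- The prefixes of the words in `S`; the empty word is always included. -/
def wordPrefixes (S : List (GroupWord α)) : List (GroupWord α) := 
  [] :: S.flatMap fun s => (List.range (s.length + 1)).map fun i => s.take i

theorem mem_wordPrefixes {S : List (GroupWord α)} {p : GroupWord α} :
    p ∈ wordPrefixes S ↔ p = [] ∨ ∃ s ∈ S, p <+: s := by
  simp only [wordPrefixes, List.mem_cons, List.mem_flatMap, List.mem_map, List.mem_range]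
  refine or_congr_right (exists_congr fun s => and_congr_right fun _ => ⟨?_, fun h => ?_⟩)
  · rintro ⟨i, -, rfl⟩
    exact List.take_prefix _ _
  · exact ⟨p.length, Nat.lt_succ_of_le h.length_le, (List.prefix_iff_eq_take.1 h).symm⟩

/-- `InCosets H P q` says that `q` lies in a right coset `H p` with `p` in the list `P`. For
`P = wordPrefixes S` and `H = wordSubgroup S` these cosets are the vertices of the Schreier graph of
`H` visited by the closed paths at the base vertex labelled by the words in `S`. -/
def InCosets (H : Subgroup (FreeGroup α)) (P : List (GroupWord α)) (q : FreeGroup α) : Prop :=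
  ∃ p ∈ P, q * (mk p)⁻¹ ∈ H

theorem InCosets.mul_left {H : Subgroup (FreeGroup α)} {P : List (GroupWord α)} {h q : FreeGroup α}
    (hh : h ∈ H) (hq : InCosets H P q) : InCosets H P (h * q) := by
  obtain ⟨p, hp, hpq⟩ := hq
  exact ⟨p, hp, by rw [mul_assoc]; exact mul_mem hh hpq⟩

/-- `PathIn C w` says that the path labelled `w` stays in `C`. -/
def PathIn (C : FreeGroup α → Prop) (w : GroupWord α) : Prop := ∀ p, p <+: w → C (mk p)

theorem prefix_or_of_prefix_append {β : Type*} {p u v : List β} (h : p <+: u ++ v) :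
    p <+: u ∨ ∃ t, p = u ++ t ∧ t <+: v := by
  obtain ⟨s, hs⟩ := h
  rcases List.append_eq_append_iff.1 hs with ⟨t, h1, -⟩ | ⟨t, h1, h2⟩
  · exact Or.inl ⟨t, h1.symm⟩
  · exact Or.inr ⟨t, h1, s, h2.symm⟩

theorem PathIn.step {C : FreeGroup α → Prop} {u v : GroupWord α} (hu : PathIn C u)
    (h : Red.Step u v) : PathIn C v := by
  cases h with
  | @not L₁ L₂ x b =>
    intro p hp
    rcases prefix_or_of_prefix_append hp with h1 | ⟨t, rfl, ht⟩
    · exact hu p (h1.trans (List.prefix_append _ _))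
    · have h2 : mk (L₁ ++ t) = mk (L₁ ++ (x, b) :: (x, !b) :: t) :=
        (Quot.sound (Red.Step.not (L₁ := L₁) (L₂ := t))).symm
      rw [h2]
      apply hu
      obtain ⟨t', rfl⟩ := ht
      exact ⟨t', by simp⟩

theorem PathIn.red {C : FreeGroup α → Prop} {u v : GroupWord α} (hu : PathIn C u)
    (h : Red u v) : PathIn C v := by
  induction h with
  | refl => exact hu
  | tail _ h ih => exact ih.step h

theorem PathIn.toWord_mk [DecidableEq α] {C : FreeGroup α → Prop} {u : GroupWord α}
    (hu : PathIn C u) : PathIn C (mk u).toWord := by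
  rw [FreeGroup.toWord_mk]; exact hu.red reduce.red

theorem PathIn.append {C : FreeGroup α → Prop} {u v : GroupWord α} (hu : PathIn C u)
    (hv : PathIn (fun q => C (mk u * q)) v) : PathIn C (u ++ v) := by
  intro p hp
  rcases prefix_or_of_prefix_append hp with h1 | ⟨t, rfl, ht⟩
  · exact hu p h1
  · rw [← mul_mk]; exact hv t ht

theorem PathIn.mono {C D : FreeGroup α → Prop} {u : GroupWord α} (hu : PathIn C u)
    (h : ∀ q, C q → D q) : PathIn D u := fun p hp => h _ (hu p hp)

/-- Reading the reduced word of an element of `wordSubgroup S` one only visits the cosets of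
prefixes of words in `S`: this holds for the concatenations of words in `S` and their inverses, and
reducing a word only shrinks the set of visited cosets. -/
theorem pathIn_toWord_of_mem_wordSubgroup [DecidableEq α] {S : List (GroupWord α)} {h : FreeGroup α}
    (hh : h ∈ wordSubgroup S) :
    PathIn (InCosets (wordSubgroup S) (wordPrefixes S)) h.toWord := by
  set H := wordSubgroup S with hH
  suffices ∃ u, mk u = h ∧ PathIn (InCosets H (wordPrefixes S)) u by
    obtain ⟨u, rfl, hu⟩ := this
    exact hu.toWord_mk
  refine Subgroup.closure_induction (p := fun h _ => ∃ u, mk u = h ∧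
    PathIn (InCosets H (wordPrefixes S)) u) ?_ ?_ ?_ ?_ hh
  · rintro x ⟨s, hs, rfl⟩
    exact ⟨s, rfl, fun p hp => ⟨p, mem_wordPrefixes.2 (Or.inr ⟨s, hs, hp⟩),
      by rw [mul_inv_cancel]; exact one_mem H⟩⟩
  · refine ⟨[], rfl, fun p hp => ⟨[], mem_wordPrefixes.2 (Or.inl rfl), ?_⟩⟩
    rw [List.prefix_nil.1 hp, mul_inv_cancel]; exact one_mem H
  · rintro x y hx - ⟨u, rfl, hu⟩ ⟨v, rfl, hv⟩
    exact ⟨u ++ v, by rw [← mul_mk], hu.append (hv.mono fun q hq => hq.mul_left hx)⟩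
  · rintro x hx ⟨u, rfl, hu⟩
    refine ⟨invRev u, by rw [inv_mk], ?_⟩
    rintro p ⟨t, ht⟩
    have h1 : u = invRev t ++ invRev p := by rw [← invRev_append, ht, invRev_invRev]
    have h2 : mk p = (mk u)⁻¹ * mk (invRev t) := by
      rw [h1, ← mul_mk, ← inv_mk, ← inv_mk]; group
    rw [h2]
    exact (hu _ ⟨invRev p, h1.symm⟩).mul_left (inv_mem hx)

/-- If a nontrivial cyclically reduced word labels a closed path at the coset `H x`, then `H x` is
the coset of a prefix of a generator: a suitable power of the word survives cancellation in
`x c²ᴺ x⁻¹ ∈ H`. -/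
theorem inCosets_of_conj_cyclicallyReduced_mem {S : List (GroupWord α)} {c : GroupWord α}
    (hc : IsCyclicallyReduced c) (hc0 : c ≠ []) {x : FreeGroup α}
    (hx : x * mk c * x⁻¹ ∈ wordSubgroup S) : InCosets (wordSubgroup S) (wordPrefixes S) x := by
  classical
  set X := x.toWord with hX
  have hXred : IsReduced X := isReduced_toWord
  have hXinv : IsReduced (invRev X) := by rw [hX, ← toWord_inv]; exact isReduced_toWord
  set N := X.length + 1 with hN
  have hcpos : 0 < c.length := List.length_pos_iff.2 hc0
  have hCred : IsReduced (wordPow c N) := (hc.flatten_replicate N).isReduced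
  have lC := length_wordPow c N
  have hNc : N ≤ N * c.length := Nat.le_mul_of_pos_right N hcpos
  obtain ⟨P, Q, R, h1, h2, h3⟩ := exists_cancellation hXred hCred
  obtain ⟨P', Q', R', h4, h5, h6⟩ := exists_cancellation hCred hXinv
  have l1 := congrArg List.length h1
  have l2 := congrArg List.length h2
  have l4 := congrArg List.length h4
  have l5 := congrArg List.length h5
  simp only [List.length_append, invRev_length] at l1 l2 l4 l5
  have hR : R ≠ [] := by rintro rfl; simp at l2; omega
  have hP' : P' ≠ [] := by rintro rfl; simp at l4; omega
  have eR : R.getLast? = c.getLast? := by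
    rw [← List.getLast?_append_of_ne_nil (invRev Q) hR, ← h2, getLast?_wordPow c (by omega)]
  have eP' : P'.head? = c.head? := by
    rw [← List.head?_append_of_ne_nil (l₂ := Q') P' hP', ← h4, head?_wordPow c (by omega)]
  have hred : IsReduced ((P ++ R) ++ (P' ++ R')) := by
    refine List.isChain_append.2 ⟨h3, h6, ?_⟩
    intro a ha b hb
    rw [List.getLast?_append_of_ne_nil _ hR, eR] at ha
    rw [List.head?_append_of_ne_nil _ hP', eP'] at hb
    exact hc.2 a ha b hb
  have e1 : mk (P ++ R) = x * mk c ^ N := by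
    rw [pow_mk, ← wordPow, h2, ← mul_mk, ← mul_mk, ← inv_mk, ← mk_toWord (x := x), ← hX, h1,
      ← mul_mk]
    group
  have e2 : mk (P' ++ R') = mk c ^ N * x⁻¹ := by
    have : x⁻¹ = mk (invRev X) := by rw [← inv_mk, hX, mk_toWord]
    rw [pow_mk, ← wordPow, h4, this, h5, ← mul_mk, ← mul_mk, ← mul_mk, ← inv_mk]
    group
  have hpow : ∀ m : ℕ, x * mk c ^ m * x⁻¹ ∈ wordSubgroup S := fun m => by
    rw [← conj_pow]; exact pow_mem hx m
  have hmem : mk ((P ++ R) ++ (P' ++ R')) ∈ wordSubgroup S := by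
    rw [← mul_mk, e1, e2]
    have : x * mk c ^ N * (mk c ^ N * x⁻¹) = x * mk c ^ (N + N) * x⁻¹ := by
      rw [pow_add _ N N]; simp only [mul_assoc]
    rw [this]; exact hpow _
  have hpath := pathIn_toWord_of_mem_wordSubgroup hmem
  rw [toWord_mk, hred.reduce_eq] at hpath
  have hq := hpath (P ++ R) (List.prefix_append _ _)
  rw [e1] at hq
  have := hq.mul_left (inv_mem (hpow N))
  have e : (x * mk c ^ N * x⁻¹)⁻¹ * (x * mk c ^ N) = x := by group
  rwa [e] at this

/-- The words `p q⁻¹` with `p` and `q` prefixes of words in `S`. The list is usually redundant, and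
it also contains representatives `g` with `g H g⁻¹ ∩ H` trivial. -/
def bntciWords (S : List (GroupWord α)) : List (GroupWord α) :=
  (wordPrefixes S).flatMap fun p => (wordPrefixes S).map fun q => p ++ invRev q

/-- If `u = x c x⁻¹` and `g u g⁻¹` are nontrivial elements of `H` with `c` cyclically reduced, then
both `x` and `g x` lie in cosets of prefixes of generators, which determines `g` up to `H` on either
side. -/
theorem isBNTCIReps_bntciWords (S : List (GroupWord α)) :
    IsBNTCIReps (wordSubgroup S) ((bntciWords S).map mk) := by
  intro g hg
  obtain ⟨⟨u, hu1, hu2⟩, hune⟩ := Subgroup.ne_bot_iff_exists_ne_one.1 hg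
  obtain ⟨x, c, hc, rfl⟩ := exists_conj_cyclicallyReduced u
  have hc0 : c ≠ [] := by
    rintro rfl
    exact hune (Subtype.ext (by simp [← one_eq_mk]))
  obtain ⟨q, hq, hqH⟩ := inCosets_of_conj_cyclicallyReduced_mem hc hc0 hu2
  have h1 : (g * x) * mk c * (g * x)⁻¹ ∈ wordSubgroup S := by
    have := mem_conjBy.1 hu1
    have e : g * x * mk c * (g * x)⁻¹ = g⁻¹⁻¹ * (x * mk c * x⁻¹) * g⁻¹ := by group
    rwa [e]
  obtain ⟨p, hp, hpH⟩ := inCosets_of_conj_cyclicallyReduced_mem hc hc0 h1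
  refine ⟨mk (p ++ invRev q), ?_, ?_⟩
  · refine List.mem_map_of_mem ?_
    simp only [bntciWords, List.mem_flatMap, List.mem_map]
    exact ⟨p, hp, q, hq, rfl⟩
  · refine DoubleCoset.mem_doubleCoset.2 ⟨_, hpH, _, inv_mem hqH, ?_⟩
    rw [← mul_mk, ← inv_mk]; group

/-- Let `r` relate elements of the group to labels from a finite set `V` so that elements with a
common label lie in the same right coset of `K`, and so that `K` preserves labels. If the path
labelled `w` visits only labelled elements and `w` represents an element of `K`, then this element
is a product of elements of `K` of length at most `2 |V|`. -/
theorem mem_closure_short_of_pathIn {β : Type*} {K : Subgroup (FreeGroup α)} {V : Finset β}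
    {r : FreeGroup α → β → Prop} (hr : ∀ {a b v}, r a v → r b v → a * b⁻¹ ∈ K)
    (hK : ∀ {k q v}, k ∈ K → r q v → r (k * q) v) {w : GroupWord α}
    (hw : PathIn (fun q => ∃ v ∈ V, r q v) w) (hwK : mk w ∈ K) :
    mk w ∈ Subgroup.closure {x | ∃ u : GroupWord α, u.length ≤ 2 * V.card ∧ mk u ∈ K ∧ mk u = x} := by
  induction hn : w.length using Nat.strong_induction_on generalizing w with
  | _ n ih =>
    subst hn
    by_cases hlen : w.length < V.card
    · exact Subgroup.subset_closure ⟨w, by omega, hwK, rfl⟩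
    push Not at hlen
    have hex : ∀ i : ℕ, ∃ v ∈ V, r (mk (w.take i)) v := fun i => hw _ (List.take_prefix _ _)
    choose f hfV hfr using hex
    obtain ⟨i, hi, j, hj, hij, hfij⟩ := Finset.exists_ne_map_eq_of_card_lt_of_maps_to
      (s := Finset.range (V.card + 1)) (t := V) (f := f) (by simp) (fun i _ => hfV i)
    wlog hlt : i < j generalizing i j
    · exact this j hj i hi hij.symm hfij.symm (by omega)
    rw [Finset.mem_range] at hi hj
    -- `w = a ++ b ++ c` with `a` and `a ++ b` leading to the same coset of `K`
    set a := w.take i with ha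
    set ab := w.take j with hab
    set c := w.drop j with hc
    have hwc : w = ab ++ c := (List.take_append_drop j w).symm
    have la : a.length = i := by rw [ha, List.length_take]; omega
    have lab : ab.length = j := by rw [hab, List.length_take]; omega
    have hk : mk ab * (mk a)⁻¹ ∈ K := hr (hfr j) (hfij ▸ hfr i)
    have hlenw := congrArg List.length hwc
    rw [List.length_append] at hlenw
    have hmk : mk (a ++ c) = (mk ab * (mk a)⁻¹)⁻¹ * mk w := by
      rw [hwc, ← mul_mk, ← mul_mk]; group
    have hac : mk (a ++ c) ∈ K := by rw [hmk]; exact mul_mem (inv_mem hk) hwK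
    have hpath : PathIn (fun q => ∃ v ∈ V, r q v) (a ++ c) := by
      refine PathIn.append (fun p hp => hw p (hp.trans (List.take_prefix _ _))) ?_
      intro p hp
      obtain ⟨v, hv, hrv⟩ := hw (ab ++ p) (by rw [hwc]; exact (List.prefix_append_right_inj ab).2 hp)
      refine ⟨v, hv, ?_⟩
      have := hK (inv_mem hk) hrv
      have e : (mk ab * (mk a)⁻¹)⁻¹ * mk (ab ++ p) = mk a * mk p := by rw [← mul_mk]; group
      rwa [e] at this
    have h1 := ih (a ++ c).length (by rw [List.length_append]; omega) hpath hac rfl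
    have h2 : mk w = mk (ab ++ invRev a) * mk (a ++ c) := by
      rw [hmk, ← mul_mk, ← inv_mk]; group
    rw [h2]
    refine mul_mem (Subgroup.subset_closure ⟨ab ++ invRev a, ?_, ?_, rfl⟩) h1
    · rw [List.length_append, invRev_length]; omega
    · rw [← mul_mk, ← inv_mk]; exact hk

/-- An upper bound for the length of the words needed to generate `g H g⁻¹ ∩ H`, where
`H = wordSubgroup S` and `g` is represented by the word `γ`. -/
def intersectionBound (S : List (GroupWord α)) (γ : GroupWord α) : ℕ :=
  2 * ((wordPrefixes S).length * (wordPrefixes (invRev γ :: S)).length)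

/-- The subgroup `g H g⁻¹ ∩ H` is generated by its elements of bounded length. -/
theorem closure_short_eq_conjBy_inf (S : List (GroupWord α)) (γ : GroupWord α) :
    Subgroup.closure {x | ∃ u : GroupWord α, u.length ≤ intersectionBound S γ ∧
      mk u ∈ conjBy (mk γ) (wordSubgroup S) ⊓ wordSubgroup S ∧ mk u = x} =
    conjBy (mk γ) (wordSubgroup S) ⊓ wordSubgroup S := by
  classical
  set H := wordSubgroup S with hH
  set K := conjBy (mk γ) H ⊓ H with hKdef
  refine le_antisymm ((Subgroup.closure_le _).2 ?_) ?_
  · rintro x ⟨u, -, hu, rfl⟩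
    exact hu
  intro k hk
  set P := wordPrefixes S
  set P' := wordPrefixes (invRev γ :: S) with hP'
  set V : Finset (GroupWord α × GroupWord α) := P.toFinset ×ˢ P'.toFinset
  have hV : 2 * V.card ≤ intersectionBound S γ := by
    rw [Finset.card_product]
    exact Nat.mul_le_mul_left 2 (Nat.mul_le_mul (List.toFinset_card_le _) (List.toFinset_card_le _))
  let r : FreeGroup α → GroupWord α × GroupWord α → Prop := fun q v =>
    q * (mk v.1)⁻¹ ∈ H ∧ (mk γ)⁻¹ * q * (mk v.2)⁻¹ ∈ H
  have hr : ∀ {a b v}, r a v → r b v → a * b⁻¹ ∈ K := by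
    intro a b v h1 h2
    refine ⟨mem_conjBy.2 ?_, ?_⟩
    · have e : (mk γ)⁻¹ * (a * b⁻¹) * mk γ =
        ((mk γ)⁻¹ * a * (mk v.2)⁻¹) * ((mk γ)⁻¹ * b * (mk v.2)⁻¹)⁻¹ := by group
      rw [e]; exact mul_mem h1.2 (inv_mem h2.2)
    · have e : a * b⁻¹ = (a * (mk v.1)⁻¹) * (b * (mk v.1)⁻¹)⁻¹ := by group
      change a * b⁻¹ ∈ H
      rw [e]; exact mul_mem h1.1 (inv_mem h2.1)
  have hKr : ∀ {k q v}, k ∈ K → r q v → r (k * q) v := by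
    intro k q v hk hq
    refine ⟨?_, ?_⟩
    · rw [mul_assoc]; exact mul_mem hk.2 hq.1
    · have e : (mk γ)⁻¹ * (k * q) * (mk v.2)⁻¹ =
        ((mk γ)⁻¹ * k * mk γ) * ((mk γ)⁻¹ * q * (mk v.2)⁻¹) := by group
      rw [e]; exact mul_mem (mem_conjBy.1 hk.1) hq.2
  -- the path labelled `k` stays in the core when read from `H`
  have path1 : PathIn (InCosets H P) k.toWord := pathIn_toWord_of_mem_wordSubgroup hk.2
  -- read from `H g⁻¹`, it stays in the core with the path labelled `g⁻¹` attached
  have path2 : PathIn (fun q => InCosets H P' ((mk γ)⁻¹ * q)) k.toWord := by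
    set h := (mk γ)⁻¹ * k * mk γ with hh
    have hhH : h ∈ H := mem_conjBy.1 hk.1
    have hkw : k = mk (γ ++ h.toWord ++ invRev γ) := by
      rw [← mul_mk, ← mul_mk, mk_toWord, ← inv_mk, hh]; group
    have hsub : ∀ p, p <+: invRev γ → InCosets H P' (mk p) := fun p hp =>
      ⟨p, mem_wordPrefixes.2 (Or.inr ⟨_, by simp, hp⟩),
        by rw [mul_inv_cancel]; exact one_mem H⟩
    rw [hkw]
    refine PathIn.toWord_mk (PathIn.append (PathIn.append ?_ ?_) ?_)
    · rintro p ⟨s, hs⟩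
      have e : (mk γ)⁻¹ * mk p = mk (invRev s) := by
        rw [← hs, ← mul_mk, ← inv_mk]; group
      rw [e]
      exact hsub _ ⟨invRev p, by rw [← invRev_append, hs]⟩
    · refine (pathIn_toWord_of_mem_wordSubgroup hhH).mono fun q hq => ?_
      rw [inv_mul_cancel_left]
      obtain ⟨p, hp, hpq⟩ := hq
      refine ⟨p, mem_wordPrefixes.2 ?_, hpq⟩
      rcases mem_wordPrefixes.1 hp with h0 | ⟨s, hs, hps⟩
      · exact Or.inl h0
      · exact Or.inr ⟨s, by simp [hs], hps⟩
    · intro p hp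
      have e : (mk γ)⁻¹ * (mk (γ ++ h.toWord) * mk p) = h * mk p := by
        rw [← mul_mk, mk_toWord]; group
      rw [e]
      exact (hsub p hp).mul_left hhH
  have hpath : PathIn (fun q => ∃ v ∈ V, r q v) k.toWord := by
    intro p hp
    obtain ⟨v1, hv1, h1⟩ := path1 p hp
    obtain ⟨v2, hv2, h2⟩ := path2 p hp
    exact ⟨(v1, v2), by simp [V, hv1, hv2], h1, h2⟩
  have hmem := mem_closure_short_of_pathIn (r := r) hr hKr hpath (by rwa [mk_toWord])
  rw [mk_toWord] at hmem
  refine Subgroup.closure_mono ?_ hmem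
  rintro x ⟨u, hu, huK, rfl⟩
  exact ⟨u, hu.trans hV, huK, rfl⟩

end Core

/-! ### Deciding membership in a finitely generated subgroup -/

section Saturation

open FreeGroup

variable {α : Type*}

/-- A partial injection of a finite type into itself, given by its graph, extends to a
permutation. -/
theorem exists_perm_extending {Q : Type*} [Finite Q] {r : Q → Q → Prop}
    (hf : ∀ {a b c}, r a b → r a c → b = c) (hi : ∀ {a b c}, r a c → r b c → a = b) :
    ∃ π : Equiv.Perm Q, ∀ a b, r a b → π a = b := by
  classical
  have := Fintype.ofFinite Q
  have hex : ∀ a, ∃ b, (∃ b, r a b) → r a b := fun a => by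
    by_cases h : ∃ b, r a b
    · exact ⟨h.choose, fun _ => h.choose_spec⟩
    · exact ⟨a, fun h' => absurd h' h⟩
  choose f hf' using hex
  obtain ⟨g, hg⟩ := Set.MapsTo.exists_equiv_extend_of_card_eq (α := Q) (β := Q)
    (t := Finset.univ) (by simp) (s := {a | ∃ b, r a b}) (f := f) (fun _ _ => by simp)
    (fun a ha b hb hab => hi (hf' a ha) (hab ▸ hf' b hb))
  refine ⟨g.trans (Equiv.subtypeUnivEquiv fun x => Finset.mem_univ x), fun a b hab => ?_⟩
  have h1 := hg a ⟨b, hab⟩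
  exact h1.trans (hf (hf' a ⟨b, hab⟩) hab)

/-- Let `D` contain the generators of `H`, of length at most `l`, and be closed under those products
`x⁻¹ y` that have length at most `2 l`. Then `D` contains every element of `H` of length at most
`l`. Indeed, left translations by letters induce partial injections on the ball of radius `l` modulo
the relation `p⁻¹ q ∈ D`; extending them to permutations gives an action of the free group for which
`H` fixes the class of `1`. -/
theorem mem_of_saturated [Finite α] [DecidableEq α] {S : List (GroupWord α)} {l : ℕ}
    {D : Set (FreeGroup α)} (h1 : 1 ∈ D) (hS : ∀ s ∈ S, s.length ≤ l ∧ mk s ∈ D)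
    (hD : ∀ x ∈ D, ∀ y ∈ D, norm (x⁻¹ * y) ≤ 2 * l → x⁻¹ * y ∈ D)
    {w : FreeGroup α} (hw : w ∈ wordSubgroup S) (hwl : norm w ≤ l) : w ∈ D := by
  let B := {p : FreeGroup α // norm p ≤ l}
  have hfin : Finite B := by
    have : Finite {u : GroupWord α // u.length ≤ l} := (List.finite_length_le _ l).to_subtype
    refine Finite.of_injective (β := {u : GroupWord α // u.length ≤ l})
      (fun p : B => ⟨p.1.toWord, p.2⟩) ?_
    intro p q hpq
    exact Subtype.ext (toWord_injective (congrArg Subtype.val hpq))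
  have hsymm : ∀ {p q : B}, p.1⁻¹ * q.1 ∈ D → q.1⁻¹ * p.1 ∈ D := by
    intro p q h
    have := hD _ h 1 h1
    rw [mul_one, mul_inv_rev, inv_inv] at this
    refine this ((FreeGroup.norm_mul_le _ _).trans ?_)
    rw [norm_inv_eq]
    have := p.2; have := q.2; omega
  let s : Setoid B :=
    { r := fun p q => p.1⁻¹ * q.1 ∈ D
      iseqv := by
        refine ⟨fun p => by simpa using h1, hsymm, ?_⟩
        intro p q r hpq hqr
        have := hD _ (hsymm hpq) _ hqr
        have e : (q.1⁻¹ * p.1)⁻¹ * (q.1⁻¹ * r.1) = p.1⁻¹ * r.1 := by group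
        rw [e] at this
        refine this ((FreeGroup.norm_mul_le _ _).trans ?_)
        rw [norm_inv_eq]
        have := p.2; have := r.2; omega }
  let Q := Quotient s
  have hfun : ∀ x : α, ∃ π : Equiv.Perm Q, ∀ p q : B, q.1 = of x * p.1 →
      π (Quotient.mk s p) = Quotient.mk s q := by
    intro x
    obtain ⟨π, hπ⟩ := exists_perm_extending (Q := Q)
      (r := fun a b => ∃ p q : B, q.1 = of x * p.1 ∧ Quotient.mk s p = a ∧ Quotient.mk s q = b)
      (by
        rintro a b c ⟨p, q, hq, rfl, rfl⟩ ⟨p', q', hq', hp, rfl⟩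
        refine Quotient.sound (show q.1⁻¹ * q'.1 ∈ D from ?_)
        have hpp : p'.1⁻¹ * p.1 ∈ D := Quotient.exact hp
        have e : q.1⁻¹ * q'.1 = p.1⁻¹ * p'.1 := by rw [hq, hq']; group
        rw [e]; exact hsymm hpp)
      (by
        rintro a b c ⟨p, q, hq, rfl, rfl⟩ ⟨p', q', hq', rfl, hqq⟩
        refine Quotient.sound (show p.1⁻¹ * p'.1 ∈ D from ?_)
        have hqq' : q'.1⁻¹ * q.1 ∈ D := Quotient.exact hqq
        have e : p.1⁻¹ * p'.1 = q.1⁻¹ * q'.1 := by rw [hq, hq']; group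
        rw [e]; exact hsymm hqq')
    exact ⟨π, fun p q h => hπ _ _ ⟨p, q, h, rfl, rfl⟩⟩
  choose π hπ using hfun
  let φ : FreeGroup α →* Equiv.Perm Q := lift π
  have hball : ∀ u : GroupWord α, u.length ≤ l → norm (mk u) ≤ l := fun u hu => norm_mk_le.trans hu
  let o : Q := Quotient.mk s ⟨1, by simp⟩
  have key : ∀ (u : GroupWord α) (hu : u.length ≤ l),
      φ (mk u) o = Quotient.mk s ⟨mk u, hball u hu⟩ := by
    intro u
    induction u with
    | nil => 
      intro _
      have e : φ (mk []) = 1 := map_one φ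
      rw [e]; rfl
    | cons x u ih =>
      intro hu
      have hu' : u.length ≤ l := by simp at hu; omega
      have e : mk (x :: u) = mk [x] * mk u := by rw [mul_mk]; rfl
      have e' : φ (mk (x :: u)) = φ (mk [x]) * φ (mk u) := by rw [← _root_.map_mul, ← e]
      rw [e', Equiv.Perm.mul_apply, ih hu']
      obtain ⟨x, b⟩ := x
      have hφ : φ (of x) = π x := lift_apply_of
      cases b with
      | true =>
        change φ (of x) _ = _
        rw [hφ]
        exact hπ x _ _ e
      | false =>
        have e1 : mk [(x, false)] = (of x)⁻¹ := rfl
        rw [e1, _root_.map_inv, Equiv.Perm.inv_eq_iff_eq, hφ]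
        refine (hπ x _ _ (show mk u = of x * mk ((x, false) :: u) from ?_)).symm
        rw [e, e1]; group
  have hfix : ∀ v ∈ wordSubgroup S, φ v o = o := by
    have : wordSubgroup S ≤ (MulAction.stabilizer (Equiv.Perm Q) o).comap φ := by
      refine (Subgroup.closure_le _).2 ?_
      rintro x ⟨t, ht, rfl⟩
      change φ (mk t) o = o
      rw [key t (hS t ht).1]
      refine Quotient.sound (hsymm (p := ⟨1, by simp⟩) ?_)
      simpa using (hS t ht).2
    exact fun v hv => this hv
  have h2 := key w.toWord hwl
  simp only [mk_toWord] at h2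
  rw [hfix w hw] at h2
  have h3 : (1 : FreeGroup α)⁻¹ * w ∈ D := Quotient.exact h2
  simpa using h3

/-- An increasing sequence of subsets of a finite set, such that a repetition persists, is
stationary from the index given by the size of the set. -/
theorem Finset.eq_succ_of_bounded_chain {β : Type*} {F : ℕ → Finset β} {U : Finset β} {n : ℕ}
    (hU : ∀ k, F k ⊆ U) (hmono : ∀ k, F k ⊆ F (k + 1))
    (hstable : ∀ k, F k = F (k + 1) → F (k + 1) = F (k + 2)) (hn : U.card ≤ n) :
    F n = F (n + 1) := by
  have claim : ∀ k, F k = F (k + 1) ∨ k + 1 ≤ (F (k + 1)).card := by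
    intro k
    induction k with
    | zero =>
      by_cases h : F 0 = F 1
      · exact Or.inl h
      · have := Finset.card_lt_card ((hmono 0).ssubset_of_ne h)
        right; simp only [zero_add] at this ⊢; omega
    | succ k ih =>
      by_cases h : F (k + 1) = F (k + 2)
      · exact Or.inl h
      · have := Finset.card_lt_card ((hmono (k + 1)).ssubset_of_ne h)
        rcases ih with h' | h'
        · exact absurd (hstable k h') h
        · right; omega
  rcases claim n with h | h
  · exact h
  · have := Finset.card_le_card (hU (n + 1))
    omega

/-- The words of length at most `n` in the letters from the list `A`. -/
def wordsUpTo {β : Type*} (A : List β) (n : ℕ) : List (List β) :=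
  Nat.rec [[]] (fun _ W => [] :: W.flatMap fun w => A.map fun x => x :: w) n

theorem mem_wordsUpTo {β : Type*} {A : List β} (hA : ∀ x, x ∈ A) {n : ℕ} {w : List β} :
    w ∈ wordsUpTo A n ↔ w.length ≤ n := by
  induction n generalizing w with
  | zero => simp [wordsUpTo]
  | succ n ih =>
    change w ∈ [] :: (wordsUpTo A n).flatMap (fun w => A.map fun x => x :: w) ↔ _
    cases w with
    | nil => simp
    | cons x w => simp [ih, hA]

variable [DecidableEq α]

/-- One round of saturation of a list of reduced words under the products `x⁻¹ y` of length at most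
`L`. -/
def saturationStep (L : ℕ) (D : List (GroupWord α)) : List (GroupWord α) :=
  D ++ (D.flatMap fun x => D.map fun y => reduce (invRev x ++ y)).filter fun z => z.length ≤ L

theorem mem_saturationStep {L : ℕ} {D : List (GroupWord α)} {z : GroupWord α} :
    z ∈ saturationStep L D ↔
      z ∈ D ∨ (∃ x ∈ D, ∃ y ∈ D, reduce (invRev x ++ y) = z) ∧ z.length ≤ L := by
  simp [saturationStep]

/-- The length bound used when deciding whether the word `w` represents an element of
`wordSubgroup S`. -/
def membershipBound (S : List (GroupWord α)) (w : GroupWord α) : ℕ :=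
  2 * (S.flatten.length + w.length)

/-- `InWordSubgroup A S w` is the outcome of the saturation procedure applied to the reduced forms of
the words in `S`: the reduced form of `w` is reached after as many rounds as there are words of
length at most `membershipBound S w` in the letters from `A`. -/
def InWordSubgroup (A : List (α × Bool)) (S : List (GroupWord α)) (w : GroupWord α) : Prop :=
  reduce w ∈ (saturationStep (membershipBound S w))^[(wordsUpTo A (membershipBound S w)).length]
    ([] :: S.map reduce)

/-- The saturation procedure decides membership in a finitely generated subgroup. -/
theorem inWordSubgroup_iff [Finite α] {A : List (α × Bool)} (hA : ∀ x, x ∈ A)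
    {S : List (GroupWord α)} {w : GroupWord α} :
    InWordSubgroup A S w ↔ mk w ∈ wordSubgroup S := by
  unfold InWordSubgroup
  set L := membershipBound S w with hL
  set D₀ : List (GroupWord α) := [] :: S.map reduce with hD₀
  set E : ℕ → List (GroupWord α) := fun k => (saturationStep L)^[k] D₀ with hE
  have hEsucc : ∀ k, E (k + 1) = saturationStep L (E k) := fun k =>
    Function.iterate_succ_apply' _ _ _
  have hslen : ∀ s ∈ S, s.length ≤ S.flatten.length := by
    intro s hs
    rw [List.length_flatten]
    exact List.single_le_sum (by simp) _ (List.mem_map_of_mem hs)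
  change reduce w ∈ E (wordsUpTo A L).length ↔ _
  have hred : ∀ k, ∀ z ∈ E k, reduce z = z ∧ z.length ≤ L ∧ mk z ∈ wordSubgroup S := by
    intro k
    induction k with
    | zero =>
      intro z hz
      change z ∈ D₀ at hz
      rw [hD₀, List.mem_cons, List.mem_map] at hz
      rcases hz with rfl | ⟨s, hs, rfl⟩
      · exact ⟨rfl, by simp, one_mem _⟩
      · refine ⟨reduce.idem, ?_, ?_⟩
        · have h1 : (reduce s).length ≤ s.length := norm_mk_le
          have := hslen s hs
          rw [hL, membershipBound]; omega
        · rw [reduce.self]; exact Subgroup.subset_closure ⟨s, hs, rfl⟩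
    | succ k ih =>
      intro z hz
      rw [hEsucc, mem_saturationStep] at hz
      rcases hz with hz | ⟨⟨x, hx, y, hy, rfl⟩, hzL⟩
      · exact ih z hz
      · refine ⟨reduce.idem, hzL, ?_⟩
        rw [reduce.self, ← mul_mk, ← inv_mk]
        exact mul_mem (inv_mem (ih x hx).2.2) (ih y hy).2.2
  constructor
  · intro h
    have := (hred _ _ h).2.2
    rwa [reduce.self] at this
  intro hw
  have hclosed : (E (wordsUpTo A L).length).toFinset = (E ((wordsUpTo A L).length + 1)).toFinset := by
    refine Finset.eq_succ_of_bounded_chain (F := fun k => (E k).toFinset)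
      (U := (wordsUpTo A L).toFinset) ?_ ?_ ?_ (List.toFinset_card_le _)
    · intro k z hz
      rw [List.mem_toFinset] at hz ⊢
      exact (mem_wordsUpTo hA).2 (hred k z hz).2.1
    · intro k z hz
      rw [List.mem_toFinset] at hz ⊢
      rw [hEsucc, mem_saturationStep]
      exact Or.inl hz
    · intro k hk
      have hk' : ∀ z, z ∈ E k ↔ z ∈ E (k + 1) := fun z => by
        have := Finset.ext_iff.1 hk z
        simpa using this
      ext z
      rw [List.mem_toFinset, List.mem_toFinset, hEsucc (k + 1), mem_saturationStep, hEsucc k,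
        mem_saturationStep]
      simp only [← hEsucc k, ← hk']
      tauto
  set n := (wordsUpTo A L).length
  have hmemS : ∀ z ∈ D₀, z ∈ E n := by
    intro z hz
    suffices ∀ k, z ∈ E k from this n
    intro k
    induction k with
    | zero => exact hz
    | succ k ih => rw [hEsucc, mem_saturationStep]; exact Or.inl ih
  have := mem_of_saturated (S := S) (l := S.flatten.length + w.length)
    (D := {x | x.toWord ∈ E n}) (w := mk w) ?_ ?_ ?_ hw ?_
  · simpa [toWord_mk] using this
  · exact hmemS _ (by simp [hD₀])
  · intro s hs
    refine ⟨(hslen s hs).trans (Nat.le_add_right _ _), hmemS _ ?_⟩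
    rw [toWord_mk, hD₀]
    exact List.mem_cons_of_mem _ (List.mem_map_of_mem hs)
  · intro x hx y hy hxy
    have h1 : (x⁻¹ * y).toWord ∈ E (n + 1) := by
      rw [hEsucc, mem_saturationStep]
      exact Or.inr ⟨⟨_, hx, _, hy, by rw [toWord_mul, toWord_inv]⟩, hxy⟩
    have := Finset.ext_iff.1 hclosed (x⁻¹ * y).toWord
    simp only [List.mem_toFinset] at this
    exact this.2 h1
  · exact norm_mk_le.trans (Nat.le_add_left _ _)

end Saturation

/-! ### The algorithms and their correctness -/

section Algorithms

open FreeGroup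

variable {α : Type*} [DecidableEq α]

instance (A : List (α × Bool)) (S : List (GroupWord α)) (w : GroupWord α) :
    Decidable (InWordSubgroup A S w) :=
  inferInstanceAs (Decidable (_ ∈ _))

/-- Words generating `g H g⁻¹ ∩ H`, where `H = wordSubgroup S` and `g` is represented by `γ`: all
words of bounded length that represent elements of the intersection. -/
def intersectionWords (A : List (α × Bool)) (S : List (GroupWord α)) (γ : GroupWord α) :
    List (GroupWord α) :=
  (wordsUpTo A (intersectionBound S γ)).filter fun u =>
    InWordSubgroup A S u ∧ InWordSubgroup A S (invRev γ ++ u ++ γ)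

/-- BNTCI representatives for `wordSubgroup S`, each with generators of the corresponding
intersection. -/
def bntciData (A : List (α × Bool)) (S : List (GroupWord α)) :
    List (GroupWord α × List (GroupWord α)) :=
  (bntciWords S).map fun γ => (γ, intersectionWords A S γ)

/-- The bounded search deciding conjugacy stability: for each BNTCI representative `g` it looks for
a short `b` in the subgroup that conjugates the generators of `g H g⁻¹ ∩ H` in the same way as
`g`. -/
def StabilityTest (A : List (α × Bool)) (S : List (GroupWord α)) : Prop :=
  ∀ p ∈ bntciData A S, ∃ b ∈ wordsUpTo A (p.1.length + p.2.flatten.length),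
    InWordSubgroup A S b ∧
      ∀ t ∈ p.2, reduce (invRev b ++ t ++ b) = reduce (invRev p.1 ++ t ++ p.1)

theorem reduce_conj_eq_iff {b g t : GroupWord α} :
    reduce (invRev b ++ t ++ b) = reduce (invRev g ++ t ++ g) ↔
      (mk b)⁻¹ * mk t * mk b = (mk g)⁻¹ * mk t * mk g := by
  rw [inv_mk, inv_mk, mul_mk, mul_mk, mul_mk, mul_mk]
  exact ⟨reduce.exact, reduce.sound⟩

variable [Finite α] {A : List (α × Bool)}

theorem wordSubgroup_intersectionWords (hA : ∀ x, x ∈ A) (S : List (GroupWord α))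
    (γ : GroupWord α) :
    wordSubgroup (intersectionWords A S γ) =
      conjBy (mk γ) (wordSubgroup S) ⊓ wordSubgroup S := by
  rw [← closure_short_eq_conjBy_inf S γ]
  refine congrArg Subgroup.closure (Set.ext fun x => exists_congr fun u => ?_)
  rw [intersectionWords, List.mem_filter, mem_wordsUpTo hA, decide_eq_true_iff,
    inWordSubgroup_iff hA, inWordSubgroup_iff hA, Subgroup.mem_inf, mem_conjBy, ← mul_mk, ← mul_mk,
    ← inv_mk]
  tauto

theorem stabilityTest_iff (hA : ∀ x, x ∈ A) (S : List (GroupWord α)) :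
    StabilityTest A S ↔ ConjugacyStable (wordSubgroup S) := by
  constructor
  · intro h
    refine conjugacyStable_of_forall_reps (isBNTCIReps_bntciWords S) ?_
    intro g hg
    obtain ⟨γ, hγ, rfl⟩ := List.mem_map.1 hg
    obtain ⟨b, -, hb, hbt⟩ := h _ (List.mem_map_of_mem hγ)
    refine ⟨mk b, (inWordSubgroup_iff hA).1 hb, fun u hu => ?_⟩
    rw [← wordSubgroup_intersectionWords hA] at hu
    have hcl : wordSubgroup (intersectionWords A S γ) ≤
        ((MulAut.conj (mk b)⁻¹).toMonoidHom.eqLocus (MulAut.conj (mk γ)⁻¹).toMonoidHom) := by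
      refine (Subgroup.closure_le _).2 ?_
      rintro x ⟨t, ht, rfl⟩
      have := reduce_conj_eq_iff.1 (hbt t ht)
      change MulAut.conj (mk b)⁻¹ (mk t) = MulAut.conj (mk γ)⁻¹ (mk t)
      rw [MulAut.conj_apply, MulAut.conj_apply, inv_inv, inv_inv]
      exact this
    have := hcl hu
    change MulAut.conj (mk b)⁻¹ u = MulAut.conj (mk γ)⁻¹ u at this
    rwa [MulAut.conj_apply, MulAut.conj_apply, inv_inv, inv_inv] at this
  · intro hst p hp
    obtain ⟨γ, hγ, rfl⟩ := List.mem_map.1 hp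
    have hT := wordSubgroup_intersectionWords hA S γ
    obtain ⟨b, hb, hbn, hbu⟩ := hst.exists_short_conj (mk γ) hT
      (l := (intersectionWords A S γ).flatten.length) (fun t ht => by
        rw [List.length_flatten]
        exact List.single_le_sum (by simp) _ (List.mem_map_of_mem ht))
    refine ⟨b.toWord, (mem_wordsUpTo hA).2 ?_, ?_, fun t ht => ?_⟩
    · exact hbn.trans (Nat.add_le_add_right norm_mk_le _)
    · rw [inWordSubgroup_iff hA, mk_toWord]; exact hb
    · rw [reduce_conj_eq_iff, mk_toWord]
      refine hbu _ ?_
      rw [← hT]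
      exact Subgroup.subset_closure ⟨t, ht, rfl⟩

end Algorithms

/-! ### Primitive recursiveness of the algorithms -/

section Computability

open FreeGroup Primrec

variable {α : Type*} [Primcodable α]

theorem primrec_mem_list {β : Type*} [Primcodable β] :
    PrimrecRel fun (b : β) (L : List β) => b ∈ L := by
  have h : PrimrecRel fun (L : List β) (b : β) => ∃ a ∈ L, a = b :=
    PrimrecRel.exists_mem_list Primrec.eq
  exact h.swap.of_eq fun b L => by simp [Function.swap]

theorem primrec_invRev : Primrec (invRev : GroupWord α → GroupWord α) := by
  have h : Primrec fun x : α × Bool => (x.1, !x.2) := fst.pair (Primrec.not.comp snd)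
  exact list_reverse.comp (list_map .id (h.comp snd).to₂)

theorem primrec_reduce [DecidableEq α] : Primrec (reduce : GroupWord α → GroupWord α) := by
  have hstep : Primrec₂ fun (_ : GroupWord α) (p : (α × Bool) × GroupWord α) =>
      (List.casesOn p.2 [p.1] fun y L =>
        if p.1.1 = y.1 ∧ p.1.2 = !y.2 then L else p.1 :: y :: L : GroupWord α) := by
    refine list_casesOn (f := fun q : GroupWord α × (α × Bool) × GroupWord α => q.2.2)
      (g := fun q => [q.2.1])
      (h := fun q r => if q.2.1.1 = r.1.1 ∧ q.2.1.2 = !r.1.2 then r.2 else q.2.1 :: r.1 :: r.2)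
      (snd.comp snd) (list_cons.comp (fst.comp snd) (const [])) ?_
    have hx : Primrec fun q : (GroupWord α × (α × Bool) × GroupWord α) × (α × Bool) × GroupWord α =>
        q.1.2.1 := fst.comp (snd.comp fst)
    have hy : Primrec fun q : (GroupWord α × (α × Bool) × GroupWord α) × (α × Bool) × GroupWord α =>
        q.2.1 := fst.comp snd
    have hL : Primrec fun q : (GroupWord α × (α × Bool) × GroupWord α) × (α × Bool) × GroupWord α =>
        q.2.2 := snd.comp snd
    exact Primrec.ite ((Primrec.eq.comp (fst.comp hx) (fst.comp hy)).and
      (Primrec.eq.comp (snd.comp hx) (Primrec.not.comp (snd.comp hy)))) hL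
      (list_cons.comp hx (list_cons.comp hy hL))
  refine (list_foldr .id (const []) hstep).of_eq fun w => ?_
  induction w with
  | nil => rfl
  | cons x w ih =>
    rw [reduce.cons, ← ih]
    rfl

theorem primrec_wordPrefixes :
    Primrec (wordPrefixes : List (GroupWord α) → List (GroupWord α)) := by
  have h : Primrec fun s : GroupWord α => (List.range (s.length + 1)).map fun i => s.take i :=
    list_map (list_range.comp (succ.comp list_length)) (list_take.comp snd fst).to₂
  exact list_cons.comp (const []) (list_flatMap .id (h.comp snd).to₂)

theorem primrec_bntciWords : Primrec (bntciWords : List (GroupWord α) → List (GroupWord α)) :=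
  list_flatMap primrec_wordPrefixes
    (list_map (primrec_wordPrefixes.comp fst)
      (list_append.comp (snd.comp fst) (primrec_invRev.comp snd)).to₂).to₂

theorem primrec_intersectionBound :
    Primrec₂ (intersectionBound : List (GroupWord α) → GroupWord α → ℕ) :=
  nat_mul.comp (const 2) (nat_mul.comp (list_length.comp (primrec_wordPrefixes.comp fst))
    (list_length.comp (primrec_wordPrefixes.comp (list_cons.comp (primrec_invRev.comp snd) fst))))

theorem primrec_wordsUpTo {β : Type*} [Primcodable β] (A : List β) : Primrec (wordsUpTo A) := by
  have h : Primrec₂ fun (_ : ℕ) (W : List (List β)) =>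
      [] :: W.flatMap fun w => A.map fun x => x :: w :=
    list_cons.comp (const []) (list_flatMap snd
      (list_map (const A) (list_cons.comp snd (snd.comp fst)).to₂).to₂)
  exact nat_rec₁ [[]] h

theorem primrec_membershipBound :
    Primrec₂ (membershipBound : List (GroupWord α) → GroupWord α → ℕ) :=
  nat_mul.comp (const 2)
    (nat_add.comp (list_length.comp (list_flatten.comp fst)) (list_length.comp snd))

variable [DecidableEq α]

theorem primrec_saturationStep :
    Primrec₂ (saturationStep : ℕ → List (GroupWord α) → List (GroupWord α)) := by
  have hprod : Primrec fun p : ℕ × List (GroupWord α) =>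
      p.2.flatMap fun x => p.2.map fun y => reduce (invRev x ++ y) :=
    list_flatMap snd (list_map (snd.comp fst)
      (primrec_reduce.comp
        (list_append.comp (primrec_invRev.comp (snd.comp fst)) snd)).to₂).to₂
  have hfilter : Primrec₂ fun (D : List (GroupWord α)) (L : ℕ) =>
      D.filter fun z => decide (z.length ≤ L) :=
    PrimrecRel.listFilter (R := fun (z : GroupWord α) (L : ℕ) => z.length ≤ L)
      (nat_le.comp (list_length.comp fst) snd)
  exact list_append.comp snd (hfilter.comp hprod fst)

theorem primrec_inWordSubgroup (A : List (α × Bool)) : PrimrecRel (InWordSubgroup A) := by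
  refine primrec_mem_list.comp (primrec_reduce.comp snd) ?_
  refine nat_iterate (f := fun p : List (GroupWord α) × GroupWord α =>
      (wordsUpTo A (membershipBound p.1 p.2)).length)
    (g := fun p => [] :: p.1.map reduce) (h := fun p => saturationStep (membershipBound p.1 p.2))
    (list_length.comp ((primrec_wordsUpTo A).comp primrec_membershipBound))
    (list_cons.comp (const []) (list_map fst (primrec_reduce.comp snd).to₂))
    (primrec_saturationStep.comp (primrec_membershipBound.comp (fst.comp fst) (snd.comp fst)) snd).to₂

theorem primrec_intersectionWords (A : List (α × Bool)) :
    Primrec₂ (intersectionWords A) := by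
  have hR : PrimrecRel fun (u : GroupWord α) (p : List (GroupWord α) × GroupWord α) =>
      InWordSubgroup A p.1 u ∧ InWordSubgroup A p.1 (invRev p.2 ++ u ++ p.2) :=
    ((primrec_inWordSubgroup A).comp (fst.comp snd) fst).and
      ((primrec_inWordSubgroup A).comp (fst.comp snd)
        (list_append.comp
          (list_append.comp (primrec_invRev.comp (snd.comp snd)) fst) (snd.comp snd)))
  exact hR.listFilter.comp ((primrec_wordsUpTo A).comp primrec_intersectionBound) .id

theorem primrec_bntciData (A : List (α × Bool)) : Primrec (bntciData A) :=
  list_map primrec_bntciWords (snd.pair (primrec_intersectionWords A)).to₂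

theorem primrec_stabilityTest (A : List (α × Bool)) : PrimrecPred (StabilityTest A) := by
  have hconj : PrimrecRel fun (t : GroupWord α) (p : GroupWord α × GroupWord α) =>
      reduce (invRev p.1 ++ t ++ p.1) = reduce (invRev p.2 ++ t ++ p.2) := by
    have h : ∀ {f : GroupWord α × GroupWord α → GroupWord α}, Primrec f →
        Primrec fun q : GroupWord α × GroupWord α × GroupWord α =>
          reduce (invRev (f q.2) ++ q.1 ++ f q.2) := fun hf =>
      primrec_reduce.comp (list_append.comp
        (list_append.comp (primrec_invRev.comp (hf.comp snd)) fst) (hf.comp snd))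
    exact Primrec.eq.comp (h fst) (h snd)
  have hb : PrimrecRel fun (b : GroupWord α)
      (q : (GroupWord α × List (GroupWord α)) × List (GroupWord α)) =>
      InWordSubgroup A q.2 b ∧
        ∀ t ∈ q.1.2, reduce (invRev b ++ t ++ b) = reduce (invRev q.1.1 ++ t ++ q.1.1) :=
    ((primrec_inWordSubgroup A).comp (snd.comp snd) fst).and
      (hconj.forall_mem_list.comp (snd.comp (fst.comp snd)) (fst.pair (fst.comp (fst.comp snd))))
  have hp : PrimrecRel fun (p : GroupWord α × List (GroupWord α)) (S : List (GroupWord α)) =>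
      ∃ b ∈ wordsUpTo A (p.1.length + p.2.flatten.length), InWordSubgroup A S b ∧
        ∀ t ∈ p.2, reduce (invRev b ++ t ++ b) = reduce (invRev p.1 ++ t ++ p.1) :=
    hb.exists_mem_list.comp ((primrec_wordsUpTo A).comp (nat_add.comp
      (list_length.comp (fst.comp fst)) (list_length.comp (list_flatten.comp (snd.comp fst))))) .id
  exact hp.forall_mem_list.comp (primrec_bntciData A) .id

end Computability

/-! ### Conjugacy stability, representatives and intersections -/

theorem proposition3p1 {X : Type*} [Finite X] [Primcodable X] :
    -- conjugacy stability of the subgroup generated by a given finite list of words is decidable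
    ComputablePred (fun S : List (GroupWord X) => ConjugacyStable (wordSubgroup S)) ∧
    -- BNTCI representatives `g`, each with finitely many generators of `g H g⁻¹ ∩ H`, are computable
    (∃ A : List (GroupWord X) → List (GroupWord X × List (GroupWord X)),
      Computable A ∧
      ∀ S : List (GroupWord X),
        IsBNTCIReps (wordSubgroup S) ((A S).map fun p => FreeGroup.mk p.1) ∧
        ∀ p ∈ A S,
          wordSubgroup p.2 = conjBy (FreeGroup.mk p.1) (wordSubgroup S) ⊓ wordSubgroup S) ∧
    -- the criterion, for every system of BNTCI representatives
    (∀ H : Subgroup (FreeGroup X), H.FG →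
      ∀ R : List (FreeGroup X), IsBNTCIReps H R →
        (ConjugacyStable H ↔
          ∀ g ∈ R, g ∉ H → conjBy g H ⊓ H ≠ ⊥ →
            ∃ (h : FreeGroup X) (n : ℕ), IsRootElement h ∧ 2 ≤ n ∧
              conjBy g H ⊓ H = Subgroup.zpowers (h ^ n) ∧
              ∃ c ∈ Subgroup.zpowers h, c * g ∈ H)) := by
  classical
  obtain ⟨A, hA⟩ : ∃ A : List (X × Bool), ∀ x, x ∈ A := by
    have := Fintype.ofFinite (X × Bool)
    exact ⟨Finset.univ.toList, by simp⟩
  refine ⟨?_, ⟨bntciData A, (primrec_bntciData A).to_comp, fun S => ⟨?_, ?_⟩⟩, ?_⟩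
  · exact ((primrec_stabilityTest A).of_eq (stabilityTest_iff hA)).computablePred
  · have := isBNTCIReps_bntciWords S
    simpa [bntciData, Function.comp_def] using this
  · intro p hp
    obtain ⟨γ, -, rfl⟩ := List.mem_map.1 hp
    exact wordSubgroup_intersectionWords hA S γ
  · intro H _ R hR
    exact ⟨fun hst g _ => hst.exists_root, fun h =>
      conjugacyStable_of_forall_reps hR fun g hg => exists_conj_eq_of_exists_root (h g hg)⟩
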